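/- **Theorem (Achievability of covert phase sensing).** Let $\eta\in(0,1)$, $\bar n_{\rm B}>0$ and $\epsilon>0$. In each of $n\ge 1$ modes a probe enters a beamsplitter of transmissivity $\eta$ whose other input port carries a thermal state of mean photon number $\bar n_{\rm B}$. The first output mode (coefficient $\sqrt\eta$ on the probe) acquires an unknown phase $\theta\in(-\frac{\pi}{2},\frac{\pi}{2})$ and is received by the sensor; the second output mode (coefficient $\sqrt{1-\eta}$ on the probe) is captured entirely by the adversary. The sensor sends the coherent states $\bigotimes_{i=1}^n|\alpha_i\rangle$, where $\alpha_1,\dots,\alpha_n$ are i.i.d. with density $e^{-|\alpha|^2/\bar n_{\rm S}}/(\pi\bar n_{\rm S})$ on $\mathbb C$, are known to the sensor and unknown to the adversary, and $$\bar n_{\rm S}=\frac{4\epsilon\sqrt{\eta\bar n_{\rm B}(1+\eta\bar n_{\rm B})}}{\sqrt n\,(1-\eta)} .$$ It measures each received mode with an ideal heterodyne receiver (the measurement with outcome density $\langle\beta|\rho|\beta\rangle/\pi$ on $\mathbb C$ for a received state $\rho$), obtaining $x_1,\dots,x_n\in\mathbb C$, and computes $$\hat\theta_n=\tan^{-1}\!\left(\frac{\sum_{i=1}^n\operatorname{Im}(\overline{\alpha_i}\,x_i)}{\sum_{i=1}^n\operatorname{Re}(\overline{\alpha_i}\,x_i)}\right).$$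 1. Let $\rho_0^{(n)}$ be the adversary's $n$-mode state when the input is the vacuum, and $\rho_1^{(n)}$ his state, averaged over $\alpha_1,\dots,\alpha_n$, when the probe is sent. Then for every $n\ge1$ and every binary quantum test on the $n$ captured modes, that is, every operator $0\le E\le 1$ on the $n$-mode Fock space, the detection error probability satisfies $$\mathbb P_{\rm e}^{(\rm det)}=\tfrac12\left(\operatorname{Tr}[\rho_0^{(n)}E]+\operatorname{Tr}[\rho_1^{(n)}(1-E)]\right)\ \ge\ \tfrac12-\epsilon .$$ 2. For every fixed $\theta\in(-\frac\pi2,\frac\pi2)$, the mean squared error over the amplitudes and the measurement outcomes satisfies, as $n\to\infty$, $$\langle(\theta-\hat\theta_n)^2\rangle=\mathcal O(1/\sqrt n),\qquad \langle(\theta-\hat\theta_n)^2\rangle\sim\frac{c_{\rm het}}{\epsilon\sqrt n},\qquad c_{\rm het}=\frac{(1-\eta)\left(1+\bar n_{\rm B}(1-\eta)\right)}{8\eta\sqrt{\eta\bar n_{\rm B}(1+\eta\bar n_{\rm B})}} .$$ -/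

import Mathlib

open MeasureTheory Filter Asymptotics
open scoped Kronecker ComplexConjugate

namespace CovertSensing

noncomputable section

/-! Quantum states are described by their density matrices in the Fock (photon number) basis: a
one-mode state is a matrix indexed by `ℕ`, a two-mode state by `ℕ × ℕ`, an `n`-mode state by
`Fin n → ℕ`. -/

/-- Amplitude `⟨k|α⟩` of the coherent state `|α⟩` on the Fock state `|k⟩`. -/
def coherentAmp (α : ℂ) (k : ℕ) : ℂ :=
  (Real.exp (-‖α‖ ^ 2 / 2) : ℂ) * α ^ k / (Real.sqrt (k.factorial : ℝ) : ℂ)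

/-- The coherent state `|α⟩⟨α|`; for `α = 0` this is the vacuum. -/
def coherentState (α : ℂ) : Matrix ℕ ℕ ℂ :=
  Matrix.of fun j k => coherentAmp α j * conj (coherentAmp α k)

/-- The thermal state with mean photon number `N`. -/
def thermalState (N : ℝ) : Matrix ℕ ℕ ℂ :=
  Matrix.diagonal fun k => ((N ^ k / (1 + N) ^ (k + 1) : ℝ) : ℂ)

open Polynomial in
/-- Matrix element `⟨p,q|U|j,k⟩` of the unitary `U` of a beamsplitter of transmissivity `η`, which
maps the creation operators of its two input modes to `√η a† + √(1-η) b†` and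
`-√(1-η) a† + √η b†` respectively, where `a` and `b` are the two output modes. Hence `U|j,k⟩` is
`(√η a† + √(1-η) b†)^j (-√(1-η) a† + √η b†)^k |0,0⟩ / √(j! k!)`, and `⟨p,q|U|j,k⟩` is `√(p! q!)`
times the coefficient of `(a†)^p (b†)^q` in this expression. The expression is homogeneous of degree
`j + k`, so that for `p + q = j + k` the coefficient can be read off after setting `b† = 1`. -/
def beamsplitterAmp (η : ℝ) (out inp : ℕ × ℕ) : ℝ :=
  if out.1 + out.2 = inp.1 + inp.2 then
    Real.sqrt ((out.1.factorial : ℝ) * out.2.factorial) /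
        Real.sqrt ((inp.1.factorial : ℝ) * inp.2.factorial) *
      (((C (Real.sqrt η) * X + C (Real.sqrt (1 - η))) ^ inp.1 *
        (-C (Real.sqrt (1 - η)) * X + C (Real.sqrt η)) ^ inp.2 : ℝ[X]).coeff out.1)
  else 0

/-- The state `U ρ U†` at the output of the beamsplitter. As `U` conserves the total photon number,
the sums over the inner indices are finite. -/
def beamsplitter (η : ℝ) (ρ : Matrix (ℕ × ℕ) (ℕ × ℕ) ℂ) : Matrix (ℕ × ℕ) (ℕ × ℕ) ℂ :=
  Matrix.of fun a a' =>
    ∑ b ∈ Finset.HasAntidiagonal.antidiagonal (a.1 + a.2),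
    ∑ b' ∈ Finset.HasAntidiagonal.antidiagonal (a'.1 + a'.2),
      (beamsplitterAmp η a b : ℂ) * ρ b b' * conj (beamsplitterAmp η a' b' : ℂ)

/-- Partial trace over the first of two modes. -/
def traceFst (ρ : Matrix (ℕ × ℕ) (ℕ × ℕ) ℂ) : Matrix ℕ ℕ ℂ :=
  Matrix.of fun q q' => ∑' p, ρ (p, q) (p, q')

/-- Partial trace over the second of two modes. -/
def traceSnd (ρ : Matrix (ℕ × ℕ) (ℕ × ℕ) ℂ) : Matrix ℕ ℕ ℂ :=
  Matrix.of fun p p' => ∑' q, ρ (p, q) (p', q)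

/-- Phase rotation by `θ`, that is conjugation by `exp (i θ a†a)`. -/
def phaseRotation (θ : ℝ) (ρ : Matrix ℕ ℕ ℂ) : Matrix ℕ ℕ ℂ :=
  Matrix.of fun j k => Complex.exp (Complex.I * θ * j) * ρ j k *
    conj (Complex.exp (Complex.I * θ * k))

/-- What the sensor receives when it sends the one-mode probe `ρ` into a beamsplitter of
transmissivity `η` whose other input port carries thermal noise of mean photon number `nB`: the
first output mode, rotated by the unknown phase `θ`. -/
def sensorOutput (η nB θ : ℝ) (ρ : Matrix ℕ ℕ ℂ) : Matrix ℕ ℕ ℂ :=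
  phaseRotation θ (traceSnd (beamsplitter η (ρ ⊗ₖ thermalState nB)))

/-- What the adversary captures in the same situation: the whole second output mode. -/
def adversaryOutput (η nB : ℝ) (ρ : Matrix ℕ ℕ ℂ) : Matrix ℕ ℕ ℂ :=
  traceFst (beamsplitter η (ρ ⊗ₖ thermalState nB))

/-- Tensor product of `n` one-mode states. -/
def tensorState {n : ℕ} (ρ : Fin n → Matrix ℕ ℕ ℂ) : Matrix (Fin n → ℕ) (Fin n → ℕ) ℂ :=
  Matrix.of fun k l => ∏ i, ρ i (k i) (l i)

/-- The zero-mean isotropic complex Gaussian law with density `exp (-|α|²/N) / (π N)`. -/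
def complexGaussian (N : ℝ) : Measure ℂ :=
  volume.withDensity fun α => ENNReal.ofReal (Real.exp (-‖α‖ ^ 2 / N) / (Real.pi * N))

/-- The joint law of `n` independent amplitudes with mean photon number `nS` each. -/
def probeLaw (n : ℕ) (nS : ℝ) : Measure (Fin n → ℂ) :=
  Measure.pi fun _ => complexGaussian nS

/-- The adversary's `n`-mode state when there is no probe (vacuum input). -/
def adversaryIdle (η nB : ℝ) (n : ℕ) : Matrix (Fin n → ℕ) (Fin n → ℕ) ℂ :=
  tensorState fun _ => adversaryOutput η nB (coherentState 0)

/-- The adversary's `n`-mode state when the probe is `|α₁⟩ ⊗ ⋯ ⊗ |αₙ⟩` with independent Gaussian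
amplitudes of mean photon number `nS`, which the adversary does not know. -/
def adversaryProbed (η nB nS : ℝ) (n : ℕ) : Matrix (Fin n → ℕ) (Fin n → ℕ) ℂ :=
  Matrix.of fun k l => ∫ α, tensorState (fun i => adversaryOutput η nB (coherentState (α i))) k l
    ∂(probeLaw n nS)

/-- The `n`-mode Fock space `ℓ²(ℕⁿ)`. -/
abbrev FockSpace (n : ℕ) : Type := lp (fun _ : Fin n → ℕ => ℂ) 2

/-- Born's rule: the probability `Tr (ρ E)` of the outcome with effect `E` in the state `ρ`. The
matrix element of `E` in row `l` and column `k` is coordinate `l` of the image of the `k`-th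
vector of the Fock basis. -/
def bornProb {n : ℕ} (ρ : Matrix (Fin n → ℕ) (Fin n → ℕ) ℂ)
    (E : FockSpace n →L[ℂ] FockSpace n) : ℝ :=
  (∑' k, ∑' l, ρ k l * (E (lp.single 2 k 1) : FockSpace n) l).re

/-- Detection error probability `(P_FA + P_MD)/2` for equal priors of the adversary's binary test
`{E, 1 - E}`, where `E` is the effect of the answer that the target is being probed. -/
def detectionError (η nB nS : ℝ) {n : ℕ} (E : FockSpace n →L[ℂ] FockSpace n) : ℝ :=
  (bornProb (adversaryIdle η nB n) E + bornProb (adversaryProbed η nB nS n) (1 - E)) / 2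

/-- Density `⟨β|ρ|β⟩ / π` of the outcome `β` of ideal heterodyne detection of `ρ`. -/
def heterodyneDensity (ρ : Matrix ℕ ℕ ℂ) (β : ℂ) : ℝ :=
  (∑' j, ∑' k, conj (coherentAmp β j) * ρ j k * coherentAmp β k).re / Real.pi

/-- Law of the outcome of ideal heterodyne detection of `ρ`; the in-phase and quadrature readings
are the real and the imaginary part. -/
def heterodyneLaw (ρ : Matrix ℕ ℕ ℂ) : Measure ℂ :=
  volume.withDensity fun β => ENNReal.ofReal (heterodyneDensity ρ β)

/-- Law of the sensor's `n` heterodyne readings when the probe is `|α₁⟩ ⊗ ⋯ ⊗ |αₙ⟩`. -/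
def readingLaw (η nB θ : ℝ) {n : ℕ} (α : Fin n → ℂ) : Measure (Fin n → ℂ) :=
  Measure.pi fun i => heterodyneLaw (sensorOutput η nB θ (coherentState (α i)))

/-- The arctangent estimator, computed from the readings `x` and the amplitudes `α`, which the
sensor knows: the inverse tangent of the ratio of the averaged quadrature and in-phase components
of the readings, each referred to its probe amplitude as phase reference and weighted by its size.
Common factors are cancelled. If all `α i` are equal and positive, this is
`arctan (∑ Im (x i) / ∑ Re (x i))`. -/
def arctanEstimator {n : ℕ} (α x : Fin n → ℂ) : ℝ :=
  Real.arctan ((∑ i, (conj (α i) * x i).im) / ∑ i, (conj (α i) * x i).re)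

/-- Mean squared error of the estimator over the random amplitudes and the readings. -/
def meanSquaredError (η nB nS θ : ℝ) (n : ℕ) : ℝ :=
  ∫ α, ∫ x, (θ - arctanEstimator α x) ^ 2 ∂(readingLaw η nB θ α) ∂(probeLaw n nS)

/-- Mean photon number per mode of the probe. -/
def covertPhotonNumber (η nB ε : ℝ) (n : ℕ) : ℝ :=
  4 * ε * Real.sqrt (η * nB * (1 + η * nB)) / (Real.sqrt n * (1 - η))

/-- The constant of the heterodyne receiver. -/
def cHet (η nB : ℝ) : ℝ :=
  (1 - η) * (1 + nB * (1 - η)) / (8 * η * Real.sqrt (η * nB * (1 + η * nB)))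

end

end CovertSensing

namespace CovertSensing

/-! ### Isotropic complex Gaussian laws -/

/-! Thermal noise and the averaged probe are both Gaussian mixtures of coherent states, and a
beamsplitter sends a product of coherent states to the product with rotated amplitudes
(`beamsplitter_coherentState`). Everything thereby reduces to complex Gaussian laws, which are
identified by their characteristic functions.

Covertness. The adversary compares `n` copies of two thermal states, of means `N = η nB` and `N + δ`
with `δ = (1 - η) nS` (`adversaryIdle_eq`, `adversaryProbed_eq`). Both are diagonal in the Fock
basis, so only the diagonal of `E` matters and the test is classical. Its advantage is controlled by
the Bhattacharyya coefficient (`tsum_sq_sub_sq_mul_le`). One mode contributes at most `δ² / (4 N (1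
+ N))` to `1 - b²` (`one_sub_bhattacharyya_sq_le`), Bernoulli's inequality gives `n` times this for
`n` modes, and `nS` is chosen to make the total `(2ε)²`.

Estimation. Given the amplitudes, each reading is `exp (iθ) √η α` plus Gaussian noise of variance `V
= 1 + (1 - η) nB` (`heterodyneLaw_sensorOutput`). With `A = ∑ ‖α i‖²`, the matched-filter sum is a
positive multiple of `exp (iθ) (1 + √t w)`, where `t = V / (η A)` and `w` is a standard complex
Gaussian. To first order only the imaginary part of the noise shifts the phase, and it carries half
of the variance, so the conditional error is `∼ t / 2` (`tendsto_noisyPhaseError_div`). Finally `A`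
has mean `n nS`, of order `√n`, and relative variance `1 / n` (`integral_probe_energy_sub_sq`). As
the squared error never exceeds `π²`, the atypical amplitudes are negligible even after
multiplication by `√n` (`tendsto_sqrt_mul_integral`). -/

theorem integral_complexGaussian {E : Type*} [NormedAddCommGroup E] [NormedSpace ℝ E] {N : ℝ}
    (hN : 0 < N) (f : ℂ → E) :
    ∫ z, f z ∂(complexGaussian N) = ∫ z, (Real.exp (-‖z‖ ^ 2 / N) / (Real.pi * N)) • f z := by
  rw [complexGaussian, integral_withDensity_eq_integral_toReal_smul (by fun_prop) (by simp)]
  congr 1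
  ext z
  rw [ENNReal.toReal_ofReal (by positivity)]

theorem charFun_complexGaussian {N : ℝ} (hN : 0 < N) (t : ℂ) :
    charFun (complexGaussian N) t = Complex.exp (-(N * ‖t‖ ^ 2 / 4 : ℝ)) := by
  have h := GaussianFourier.integral_cexp_neg_mul_sq_norm_add (V := ℂ) (b := ((1 / N : ℝ) : ℂ))
    (by rw [Complex.ofReal_re]; positivity) Complex.I t
  have hN' : (N : ℂ) ≠ 0 := by exact_mod_cast hN.ne'
  have hpi : (Real.pi : ℂ) ≠ 0 := by exact_mod_cast Real.pi_ne_zero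
  rw [charFun_apply, integral_complexGaussian hN]
  calc _ = ∫ z : ℂ, ((Real.pi * N : ℝ) : ℂ)⁻¹ *
        Complex.exp (-((1 / N : ℝ) : ℂ) * ‖z‖ ^ 2 + Complex.I * (inner ℝ t z : ℝ)) := by
        congr 1
        ext z
        rw [Complex.exp_add, real_inner_comm, Complex.real_smul]
        push_cast
        rw [mul_comm Complex.I, div_eq_inv_mul, mul_assoc]
        congr 3
        field_simp
    _ = _ := by
        rw [integral_const_mul, h, Complex.finrank_real_complex]
        have : (((2 : ℕ) : ℂ) / 2) = 1 := by norm_num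
        rw [this, Complex.cpow_one, Complex.I_sq]
        push_cast
        rw [← mul_assoc]
        have e : ((Real.pi : ℂ) * N)⁻¹ * (Real.pi / (1 / N)) = 1 := by field_simp
        rw [e, one_mul]
        congr 1
        field_simp

theorem isProbabilityMeasure_complexGaussian {N : ℝ} (hN : 0 < N) :
    IsProbabilityMeasure (complexGaussian N) := by
  -- The characteristic function at `0` is the total mass.
  have h := charFun_complexGaussian hN 0
  rw [charFun_zero] at h
  have h' : (complexGaussian N).real Set.univ = 1 := by
    have : Complex.exp (-(N * ‖(0 : ℂ)‖ ^ 2 / 4 : ℝ)) = 1 := by simp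
    rw [this] at h
    exact_mod_cast h
  constructor
  rw [measureReal_def] at h'
  rwa [ENNReal.toReal_eq_one_iff] at h'

theorem inner_mul_left_complex (c z t : ℂ) : inner ℝ (c * z) t = inner ℝ z (conj c * t) := by
  rw [Complex.inner, Complex.inner, map_mul]
  congr 1
  ring

theorem charFun_map_affine_complexGaussian {N : ℝ} (hN : 0 < N) (m c t : ℂ) :
    charFun ((complexGaussian N).map fun z => m + c * z) t =
      Complex.exp ((inner ℝ m t : ℝ) * Complex.I - (N * ‖c‖ ^ 2 * ‖t‖ ^ 2 / 4 : ℝ)) := by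
  rw [charFun_apply, integral_map (by fun_prop) (by fun_prop)]
  simp only [inner_add_left, inner_mul_left_complex, Complex.ofReal_add, add_mul, Complex.exp_add]
  rw [integral_const_mul, ← charFun_apply, charFun_complexGaussian hN, ← Complex.exp_add]
  congr 1
  rw [norm_mul, RCLike.norm_conj]
  push_cast
  ring

theorem complexGaussian_map_mul {N : ℝ} (hN : 0 < N) {c : ℂ} (hc : c ≠ 0) :
    (complexGaussian N).map (fun z => c * z) = complexGaussian (N * ‖c‖ ^ 2) := by
  have := isProbabilityMeasure_complexGaussian hN
  have hN' : 0 < N * ‖c‖ ^ 2 := by positivity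
  have := isProbabilityMeasure_complexGaussian hN'
  have : IsProbabilityMeasure ((complexGaussian N).map fun z => c * z) :=
    Measure.isProbabilityMeasure_map (by fun_prop)
  apply Measure.ext_of_charFun
  ext t
  have h := charFun_map_affine_complexGaussian hN 0 c t
  simp only [zero_add] at h
  rw [h, charFun_complexGaussian hN']
  simp

theorem complexGaussian_conv {M N : ℝ} (hM : 0 < M) (hN : 0 < N) :
    (complexGaussian M).conv (complexGaussian N) = complexGaussian (M + N) := by
  have := isProbabilityMeasure_complexGaussian hM
  have := isProbabilityMeasure_complexGaussian hN
  have := isProbabilityMeasure_complexGaussian (add_pos hM hN)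
  apply Measure.ext_of_charFun
  ext t
  rw [charFun_conv, charFun_complexGaussian hM, charFun_complexGaussian hN,
    charFun_complexGaussian (add_pos hM hN), ← Complex.exp_add]
  congr 1
  push_cast
  ring

theorem integral_pow_norm_mul_exp {b : ℝ} (hb : 0 < b) (k : ℕ) :
    ∫ z : ℂ, ‖z‖ ^ (2 * k) * Real.exp (-b * ‖z‖ ^ 2) =
      Real.pi * k.factorial / b ^ (k + 1) := by
  have h := Complex.integral_rpow_mul_exp_neg_mul_rpow (p := 2) (q := 2 * k) (b := b)
    (by norm_num) (by have : (0 : ℝ) ≤ k := Nat.cast_nonneg k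
                      linarith) hb
  have e1 : (2 * (k : ℝ) + 2) / 2 = k + 1 := by ring
  have e2 : -(2 * (k : ℝ) + 2) / 2 = -((k + 1 : ℕ) : ℝ) := by push_cast; ring
  rw [e1, e2, Real.Gamma_nat_eq_factorial, Real.rpow_neg hb.le, Real.rpow_natCast] at h
  have e3 : ∀ z : ℂ, ‖z‖ ^ (2 * (k : ℝ)) = ‖z‖ ^ (2 * k) := fun z => by
    rw [← Real.rpow_natCast]; push_cast; rfl
  simp only [e3, Real.rpow_two] at h
  rw [h]
  field_simp

theorem integral_norm_pow_complexGaussian {N : ℝ} (hN : 0 < N) (k : ℕ) :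
    ∫ z, ‖z‖ ^ (2 * k) ∂(complexGaussian N) = k.factorial * N ^ k := by
  rw [integral_complexGaussian hN]
  have h := integral_pow_norm_mul_exp (b := 1 / N) (by positivity) k
  calc _ = ∫ z : ℂ, (Real.pi * N)⁻¹ * (‖z‖ ^ (2 * k) * Real.exp (-(1 / N) * ‖z‖ ^ 2)) := by
        congr 1
        ext z
        rw [smul_eq_mul, show -(1 / N) * ‖z‖ ^ 2 = -‖z‖ ^ 2 / N by ring]
        ring
    _ = _ := by
        rw [integral_const_mul, h, one_div, inv_pow]
        field_simp
        ring

theorem integrable_norm_pow_complexGaussian {N : ℝ} (hN : 0 < N) (k : ℕ) :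
    Integrable (fun z : ℂ => ‖z‖ ^ (2 * k)) (complexGaussian N) := by
  -- A non-integrable function has Bochner integral `0`, which contradicts the positive value of the
  -- moment.
  by_contra h
  have h0 := integral_undef h
  rw [integral_norm_pow_complexGaussian hN] at h0
  have : 0 < (k.factorial : ℝ) * N ^ k := by positivity
  exact absurd h0 (ne_of_gt this)

/-! ### Coherent states -/

theorem conj_coherentAmp (α : ℂ) (k : ℕ) :
    conj (coherentAmp α k) =
      (Real.exp (-‖α‖ ^ 2 / 2) : ℂ) * conj α ^ k / (Real.sqrt (k.factorial : ℝ) : ℂ) := by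
  simp only [coherentAmp, map_div₀, map_mul, map_pow, Complex.conj_ofReal]

theorem norm_coherentAmp (α : ℂ) (k : ℕ) :
    ‖coherentAmp α k‖ = Real.exp (-‖α‖ ^ 2 / 2) * ‖α‖ ^ k / Real.sqrt (k.factorial : ℝ) := by
  rw [coherentAmp, norm_div, norm_mul, norm_pow, Complex.norm_real, Complex.norm_real,
    Real.norm_of_nonneg (Real.exp_nonneg _), Real.norm_of_nonneg (Real.sqrt_nonneg _)]

theorem continuous_coherentAmp (k : ℕ) : Continuous fun α => coherentAmp α k := by
  unfold coherentAmp
  fun_prop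

theorem hasSum_conj_coherentAmp_mul (α β : ℂ) :
    HasSum (fun k => conj (coherentAmp α k) * coherentAmp β k)
      (Complex.exp (-(‖α‖ ^ 2 / 2 : ℝ) - (‖β‖ ^ 2 / 2 : ℝ) + conj α * β)) := by
  have h := (NormedSpace.expSeries_div_hasSum_exp (conj α * β)).mul_left
    (Complex.exp (-(‖α‖ ^ 2 / 2 : ℝ) - (‖β‖ ^ 2 / 2 : ℝ)))
  rw [← Complex.exp_eq_exp_ℂ, ← Complex.exp_add] at h
  refine h.congr_fun fun k => ?_
  rw [conj_coherentAmp, coherentAmp]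
  have hs : ((Real.sqrt (k.factorial : ℝ) : ℝ) : ℂ) * (Real.sqrt (k.factorial : ℝ) : ℝ) =
      (k.factorial : ℂ) := by
    rw [← Complex.ofReal_mul, Real.mul_self_sqrt (Nat.cast_nonneg _)]
    simp
  rw [div_mul_div_comm, hs, sub_eq_add_neg, Complex.exp_add, mul_pow]
  push_cast
  ring_nf

/-- The exponential series of `‖α‖ * ‖β‖`. Its sum is at most `1` uniformly in both amplitudes,
which makes it the dominating series in the exchanges of photon-number sums with Gaussian integrals.
-/
theorem hasSum_norm_coherentAmp_mul (α β : ℂ) :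
    HasSum (fun k => ‖coherentAmp α k‖ * ‖coherentAmp β k‖)
      (Real.exp (-(‖α‖ - ‖β‖) ^ 2 / 2)) := by
  have h := (NormedSpace.expSeries_div_hasSum_exp (‖α‖ * ‖β‖)).mul_left
    (Real.exp (-‖α‖ ^ 2 / 2) * Real.exp (-‖β‖ ^ 2 / 2))
  rw [← Real.exp_eq_exp_ℝ, ← Real.exp_add, ← Real.exp_add,
    show -‖α‖ ^ 2 / 2 + -‖β‖ ^ 2 / 2 + ‖α‖ * ‖β‖ = -(‖α‖ - ‖β‖) ^ 2 / 2 by ring,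
    Real.exp_add] at h
  refine h.congr_fun fun k => ?_
  rw [norm_coherentAmp, norm_coherentAmp, div_mul_div_comm,
    Real.mul_self_sqrt (Nat.cast_nonneg _), mul_pow]
  ring

theorem norm_coherentAmp_le_one (α : ℂ) (k : ℕ) : ‖coherentAmp α k‖ ≤ 1 := by
  have h := hasSum_norm_coherentAmp_mul α α
  rw [sub_self, zero_pow two_ne_zero, neg_zero, zero_div, Real.exp_zero] at h
  have := le_hasSum h k fun j _ => by positivity
  nlinarith [norm_nonneg (coherentAmp α k)]

theorem norm_coherentState_le_one (α : ℂ) (j k : ℕ) : ‖coherentState α j k‖ ≤ 1 := by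
  rw [coherentState, Matrix.of_apply, norm_mul, RCLike.norm_conj]
  exact mul_le_one₀ (norm_coherentAmp_le_one _ _) (norm_nonneg _) (norm_coherentAmp_le_one _ _)

theorem continuous_coherentState (j k : ℕ) : Continuous fun α => coherentState α j k := by
  simp only [coherentState, Matrix.of_apply]
  exact (continuous_coherentAmp j).mul (Complex.continuous_conj.comp (continuous_coherentAmp k))

theorem norm_coherentState_diag (α : ℂ) (k : ℕ) :
    ‖coherentState α k k‖ = ‖coherentAmp α k‖ * ‖coherentAmp α k‖ := by
  rw [coherentState, Matrix.of_apply, norm_mul, RCLike.norm_conj]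

theorem hasSum_coherentState_diag (α : ℂ) : HasSum (fun k => coherentState α k k) 1 := by
  have h := hasSum_conj_coherentAmp_mul α α
  convert h using 1
  · ext k; rw [coherentState, Matrix.of_apply, mul_comm]
  · rw [← Complex.normSq_eq_conj_mul_self, Complex.normSq_eq_norm_sq]
    push_cast
    ring_nf
    simp

theorem integrable_of_continuous_of_norm_le {μ : Measure ℂ} [IsFiniteMeasure μ] {f : ℂ → ℂ}
    (hf : Continuous f) {C : ℝ} (hC : ∀ z, ‖f z‖ ≤ C) : Integrable f μ :=
  Integrable.of_bound hf.aestronglyMeasurable C (ae_of_all _ hC)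

theorem coherentState_unit_mul {c : ℂ} (hc : ‖c‖ = 1) (α : ℂ) (j k : ℕ) :
    coherentState (c * α) j k = c ^ j * coherentState α j k * conj c ^ k := by
  simp only [coherentState, Matrix.of_apply, conj_coherentAmp]
  simp only [coherentAmp, norm_mul, hc, one_mul, map_mul, mul_pow]
  ring

/-- The Glauber–Sudarshan representation of the thermal state. -/
theorem thermalState_eq_integral {N : ℝ} (hN : 0 < N) (j k : ℕ) :
    thermalState N j k = ∫ γ, coherentState γ j k ∂(complexGaussian N) := by
  rcases eq_or_ne j k with rfl | hjk
  · rw [thermalState, Matrix.diagonal_apply_eq, integral_complexGaussian hN]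
    -- The exponent combines `1 / N` from the Gaussian density with `1` from the squared coherent
    -- amplitude.
    have h := integral_pow_norm_mul_exp (b := 1 + 1 / N) (by positivity) j
    calc _ = ((((Real.pi * N * j.factorial)⁻¹ *
          (Real.pi * j.factorial / (1 + 1 / N) ^ (j + 1))) : ℝ) : ℂ) := by
          congr 1
          rw [show 1 + 1 / N = (1 + N) / N by field_simp; ring, div_pow]
          field_simp
          ring
      _ = _ := by
          rw [← h, ← integral_const_mul, ← integral_complex_ofReal]
          congr 1
          ext γ
          have e : coherentState γ j j = ((Real.exp (-‖γ‖ ^ 2) * ‖γ‖ ^ (2 * j) /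
              j.factorial : ℝ) : ℂ) := by
            rw [coherentState, Matrix.of_apply, Complex.mul_conj, Complex.normSq_eq_norm_sq,
              norm_coherentAmp, div_pow, Real.sq_sqrt (Nat.cast_nonneg _), mul_pow, ← Real.exp_nat_mul,
              ← pow_mul, mul_comm j 2]
            congr 4
            push_cast
            ring
          rw [e, Complex.real_smul, ← Complex.ofReal_mul]
          congr 1
          rw [show -(1 + 1 / N) * ‖γ‖ ^ 2 = -‖γ‖ ^ 2 / N + -‖γ‖ ^ 2 by ring, Real.exp_add]
          field_simp
  · rw [thermalState, Matrix.diagonal_apply_ne _ hjk]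
    set J := ∫ γ, coherentState γ j k ∂(complexGaussian N) with hJ
    -- Off the diagonal, invariance of the law under rotation by one radian multiplies the integral
    -- by `exp (i (j - k))`. This factor is not `1` because `π` is irrational, so the integral
    -- vanishes.
    set c : ℂ := Complex.exp (Complex.I * (1 : ℝ)) with hcdef
    have hc : ‖c‖ = 1 := by rw [hcdef, mul_comm]; exact Complex.norm_exp_ofReal_mul_I 1
    have hc0 : c ≠ 0 := Complex.exp_ne_zero _
    have hrot : J = c ^ j * conj c ^ k * J := by
      have hm := complexGaussian_map_mul hN hc0
      rw [hc, one_pow, mul_one] at hm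
      calc J = ∫ γ, coherentState γ j k ∂((complexGaussian N).map fun z => c * z) := by rw [hm]
        _ = ∫ γ, coherentState (c * γ) j k ∂(complexGaussian N) :=
          integral_map (by fun_prop) (continuous_coherentState j k).aestronglyMeasurable
        _ = ∫ γ, (c ^ j * conj c ^ k) * coherentState γ j k ∂(complexGaussian N) := by
          congr 1
          ext γ
          rw [coherentState_unit_mul hc]
          ring
        _ = _ := by rw [integral_const_mul]
    have hne : c ^ j * conj c ^ k ≠ 1 := by
      intro h
      have hcj : conj c = Complex.exp (-(Complex.I * (1 : ℝ))) := by
        rw [hcdef, ← Complex.exp_conj, map_mul, Complex.conj_I, Complex.conj_ofReal, neg_mul]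
      rw [hcj, hcdef, ← Complex.exp_nat_mul, ← Complex.exp_nat_mul, ← Complex.exp_add,
        Complex.exp_eq_one_iff] at h
      obtain ⟨n, hn⟩ := h
      rw [Complex.ofReal_one] at hn
      have h2 : (((j : ℝ) - k : ℝ) : ℂ) * Complex.I = ((n * (2 * Real.pi) : ℝ) : ℂ) * Complex.I := by
        push_cast
        linear_combination hn
      have h3 : (j : ℝ) - k = n * (2 * Real.pi) := by
        have := mul_right_cancel₀ Complex.I_ne_zero h2
        exact_mod_cast this
      have hn0 : n ≠ 0 := by
        rintro rfl
        apply hjk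
        have : (j : ℝ) = k := by simpa [sub_eq_zero] using h3
        exact_mod_cast this
      apply irrational_pi
      refine ⟨((j : ℚ) - k) / (2 * n), ?_⟩
      push_cast
      rw [h3]
      have : (n : ℝ) ≠ 0 := by exact_mod_cast hn0
      field_simp
    have : (1 - c ^ j * conj c ^ k) * J = 0 := by linear_combination hrot
    rcases mul_eq_zero.1 this with h | h
    · exact absurd (sub_eq_zero.1 h).symm hne
    · exact h.symm

/-! ### The beamsplitter -/

open Polynomial in
theorem coeff_linear_pow (a b : ℂ) (p q : ℕ) :
    ((C a * X + C b : ℂ[X]) ^ (p + q)).coeff p = (p + q).choose p * (a ^ p * b ^ q) := by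
  rw [(Commute.all (C a * X) (C b)).add_pow', finsetSum_coeff, Finset.sum_eq_single (p, q)]
  · rw [nsmul_eq_mul, mul_pow, ← C_pow, ← C_pow, mul_right_comm, ← C_mul, ← C_eq_natCast,
      ← mul_assoc, ← C_mul, coeff_C_mul_X_pow, if_pos rfl]
  · rintro ⟨i, j⟩ hij hne
    rw [nsmul_eq_mul, mul_pow, ← C_pow, ← C_pow, mul_right_comm, ← C_mul, ← C_eq_natCast,
      ← mul_assoc, ← C_mul, coeff_C_mul_X_pow, if_neg]
    rintro rfl
    apply hne
    rw [Finset.HasAntidiagonal.mem_antidiagonal] at hij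
    simp only at hij
    rw [Prod.mk.injEq]
    exact ⟨rfl, by omega⟩
  · intro h
    exact (h (Finset.HasAntidiagonal.mem_antidiagonal.2 rfl)).elim

open Polynomial in
-- Up to normalization, the component of a coherent product with `m` photons is `(α a† + γ b†) ^ m`
-- applied to the vacuum. The beamsplitter substitutes linear forms for `a†` and `b†`, which gives
-- again the `m`-th power of a linear form, now with coefficients `μ` and `ν`.
theorem beamsplitterAmp_coherentAmp {η : ℝ} (hη : η ∈ Set.Ioo (0 : ℝ) 1) (α γ : ℂ) (p q : ℕ) :
    ∑ b ∈ Finset.HasAntidiagonal.antidiagonal (p + q),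
      (beamsplitterAmp η (p, q) b : ℂ) * (coherentAmp α b.1 * coherentAmp γ b.2) =
    coherentAmp (Real.sqrt η * α - Real.sqrt (1 - η) * γ) p *
      coherentAmp (Real.sqrt (1 - η) * α + Real.sqrt η * γ) q := by
  set r := Real.sqrt η with hr
  set s := Real.sqrt (1 - η) with hs
  have hr2 : r ^ 2 = η := Real.sq_sqrt hη.1.le
  have hs2 : s ^ 2 = 1 - η := Real.sq_sqrt (by linarith [hη.2])
  set P : ℂ[X] := C (r : ℂ) * X + C (s : ℂ)
  set Q : ℂ[X] := -C (s : ℂ) * X + C (r : ℂ)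
  set μ : ℂ := r * α - s * γ with hμ
  set ν : ℂ := s * α + r * γ with hν
  -- The map of amplitudes is orthogonal, so the Gaussian prefactors agree.
  have hnorm : ‖μ‖ ^ 2 + ‖ν‖ ^ 2 = ‖α‖ ^ 2 + ‖γ‖ ^ 2 := by
    simp only [← Complex.normSq_eq_norm_sq, Complex.normSq_apply, hμ, hν, Complex.sub_re,
      Complex.sub_im, Complex.add_re, Complex.add_im, Complex.re_ofReal_mul, Complex.im_ofReal_mul]
    have h1 : r ^ 2 + s ^ 2 = 1 := by rw [hr2, hs2]; ring
    linear_combination (α.re ^ 2 + α.im ^ 2 + γ.re ^ 2 + γ.im ^ 2) * h1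
  have hexp : (Real.exp (-‖μ‖ ^ 2 / 2) : ℂ) * (Real.exp (-‖ν‖ ^ 2 / 2) : ℂ) =
      (Real.exp (-‖α‖ ^ 2 / 2) : ℂ) * (Real.exp (-‖γ‖ ^ 2 / 2) : ℂ) := by
    rw [← Complex.ofReal_mul, ← Complex.ofReal_mul, ← Real.exp_add, ← Real.exp_add]
    congr 2
    linear_combination (-1 / 2 : ℝ) * hnorm
  have hcoeff : ∀ j k : ℕ, (((((C r * X + C s) ^ j * (-C s * X + C r) ^ k : ℝ[X]).coeff p : ℝ)) : ℂ)
      = (P ^ j * Q ^ k).coeff p := by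
    intro j k
    have := Polynomial.coeff_map (p := ((C r * X + C s) ^ j * (-C s * X + C r) ^ k : ℝ[X]))
      Complex.ofRealHom p
    rw [← Complex.ofRealHom_eq_coe, ← this]
    simp [P, Q, Polynomial.map_mul, Polynomial.map_pow]
  have hfac : ∀ m : ℕ, ((Real.sqrt (m.factorial : ℝ) : ℝ) : ℂ) ≠ 0 := fun m => by
    rw [Complex.ofReal_ne_zero]; positivity
  have hfac2 : ∀ m : ℕ, ((Real.sqrt (m.factorial : ℝ) : ℝ) : ℂ) * (Real.sqrt (m.factorial : ℝ) : ℝ) =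
      (m.factorial : ℂ) := fun m => by
    rw [← Complex.ofReal_mul, Real.mul_self_sqrt (Nat.cast_nonneg _), Complex.ofReal_natCast]
  -- Coefficient of `X ^ p` in `(C α * P + C γ * Q) ^ (p + q)`, expanded binomially and, since the
  -- base equals `C μ * X + C ν`, also directly.
  have hpoly : (∑ b ∈ Finset.HasAntidiagonal.antidiagonal (p + q),
      ((p + q).choose b.1 : ℂ) * (α ^ b.1 * γ ^ b.2) * (P ^ b.1 * Q ^ b.2).coeff p) =
      (p + q).choose p * (μ ^ p * ν ^ q) := by
    rw [← coeff_linear_pow]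
    have : (C μ * X + C ν : ℂ[X]) = C α * P + C γ * Q := by
      simp only [P, Q, hμ, hν, C_add, C_sub, C_mul]
      ring
    rw [this, (Commute.all (C α * P) (C γ * Q)).add_pow', finsetSum_coeff]
    refine Finset.sum_congr rfl fun b _ => ?_
    rw [nsmul_eq_mul, mul_pow, mul_pow, ← C_pow, ← C_pow,
      show (((p + q).choose b.1 : ℕ) : ℂ[X]) * (C (α ^ b.1) * P ^ b.1 * (C (γ ^ b.2) * Q ^ b.2)) =
        C (((p + q).choose b.1 : ℂ) * (α ^ b.1 * γ ^ b.2)) * (P ^ b.1 * Q ^ b.2) by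
        rw [C_mul, C_mul, map_natCast]; ring, coeff_C_mul]
  have hchoose : ∀ j k : ℕ, j + k = p + q →
      ((p + q).choose j : ℂ) * (j.factorial * k.factorial) = ((p + q).factorial : ℂ) := by
    intro j k h
    rw [← h]
    have := Nat.add_choose_mul_factorial_mul_factorial j k
    rw [← this, Nat.choose_symm_add]
    push_cast
    ring
  have hm0 : ((p + q).factorial : ℂ) ≠ 0 := by exact_mod_cast (Nat.factorial_ne_zero _)
  have hterm : ∀ b ∈ Finset.HasAntidiagonal.antidiagonal (p + q),
      (beamsplitterAmp η (p, q) b : ℂ) * (coherentAmp α b.1 * coherentAmp γ b.2) =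
      (Real.exp (-‖α‖ ^ 2 / 2) : ℂ) * (Real.exp (-‖γ‖ ^ 2 / 2) : ℂ) *
        ((Real.sqrt (p.factorial : ℝ) : ℂ) * (Real.sqrt (q.factorial : ℝ) : ℂ)) /
          ((p + q).factorial : ℂ) *
        (((p + q).choose b.1 : ℂ) * (α ^ b.1 * γ ^ b.2) * (P ^ b.1 * Q ^ b.2).coeff p) := by
    rintro ⟨j, k⟩ hb
    rw [Finset.HasAntidiagonal.mem_antidiagonal] at hb
    have hb' : j + k = p + q := hb
    rw [beamsplitterAmp, if_pos hb.symm]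
    simp only [← hr, ← hs]
    rw [Complex.ofReal_mul, hcoeff, Real.sqrt_mul (Nat.cast_nonneg _),
      Real.sqrt_mul (Nat.cast_nonneg _), coherentAmp, coherentAmp, ← hchoose j k hb',
      ← hfac2 j, ← hfac2 k]
    have hc0 : ((p + q).choose j : ℂ) ≠ 0 := by
      have := hchoose j k hb'
      intro h0
      rw [h0, zero_mul] at this
      exact hm0 this.symm
    have := hfac j
    have := hfac k
    push_cast
    field_simp
  rw [Finset.sum_congr rfl hterm, ← Finset.mul_sum, hpoly, coherentAmp, coherentAmp, ← hexp]
  have h1 := hchoose p q rfl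
  have hc0 : ((p + q).choose p : ℂ) ≠ 0 := by
    intro h0
    rw [h0, zero_mul] at h1
    exact hm0 h1.symm
  rw [← h1, ← hfac2 p, ← hfac2 q]
  have := hfac p
  have := hfac q
  field_simp

/-- A beamsplitter maps products of coherent states to products of coherent states. -/
theorem beamsplitter_coherentState {η : ℝ} (hη : η ∈ Set.Ioo (0 : ℝ) 1) (α γ : ℂ)
    (p q p' q' : ℕ) :
    beamsplitter η (coherentState α ⊗ₖ coherentState γ) (p, q) (p', q') =
      coherentState (Real.sqrt η * α - Real.sqrt (1 - η) * γ) p p' *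
        coherentState (Real.sqrt (1 - η) * α + Real.sqrt η * γ) q q' := by
  simp only [beamsplitter, Matrix.of_apply, Matrix.kroneckerMap_apply, coherentState]
  have h1 := beamsplitterAmp_coherentAmp hη α γ p q
  have h2 := congrArg conj (beamsplitterAmp_coherentAmp hη α γ p' q')
  rw [map_sum] at h2
  simp only [map_mul] at h2 ⊢
  rw [show ∀ a b c d : ℂ, a * b * (c * d) = (a * c) * (b * d) by intros; ring, ← h1, ← h2,
    Finset.sum_mul_sum]
  refine Finset.sum_congr rfl fun b _ => Finset.sum_congr rfl fun b' _ => ?_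
  ring

/-- The output of a beamsplitter fed with a coherent and a thermal state. -/
theorem beamsplitter_coherentState_thermalState {η nB : ℝ} (hη : η ∈ Set.Ioo (0 : ℝ) 1)
    (hnB : 0 < nB) (α : ℂ) (p q p' q' : ℕ) :
    beamsplitter η (coherentState α ⊗ₖ thermalState nB) (p, q) (p', q') =
      ∫ γ, coherentState (Real.sqrt η * α - Real.sqrt (1 - η) * γ) p p' *
        coherentState (Real.sqrt (1 - η) * α + Real.sqrt η * γ) q q' ∂(complexGaussian nB) := by
  have := isProbabilityMeasure_complexGaussian hnB
  have hint : ∀ j k, Integrable (fun γ => coherentState γ j k) (complexGaussian nB) := fun j k =>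
    integrable_of_continuous_of_norm_le (continuous_coherentState j k)
      fun γ => norm_coherentState_le_one γ j k
  simp only [← beamsplitter_coherentState hη]
  simp only [beamsplitter, Matrix.of_apply, Matrix.kroneckerMap_apply]
  have hint' : ∀ b b' : ℕ × ℕ, Integrable (fun γ => (beamsplitterAmp η (p, q) b : ℂ) *
      (coherentState α b.1 b'.1 * coherentState γ b.2 b'.2) *
      conj (beamsplitterAmp η (p', q') b' : ℂ)) (complexGaussian nB) := fun b b' =>
    (((hint _ _).const_mul _).const_mul _).mul_const _
  rw [integral_finsetSum _ fun b _ => integrable_finsetSum _ fun b' _ => hint' b b']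
  refine Finset.sum_congr rfl fun b _ => ?_
  rw [integral_finsetSum _ fun b' _ => hint' b b']
  refine Finset.sum_congr rfl fun b' _ => ?_
  rw [integral_mul_const, integral_const_mul, integral_const_mul, thermalState_eq_integral hnB]

theorem hasSum_norm_coherentState_diag (α : ℂ) : HasSum (fun k => ‖coherentState α k k‖) 1 := by
  have h := hasSum_norm_coherentAmp_mul α α
  simp only [← norm_coherentState_diag] at h
  simpa using h

/-- Partial trace over a mode that carries a mixture of coherent states. -/
theorem hasSum_integral_coherentState_diag_mul {μ : Measure ℂ} [IsProbabilityMeasure μ]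
    {u v : ℂ → ℂ} (hu : Continuous u) (hv : Continuous v) (j k : ℕ) :
    HasSum (fun p => ∫ γ, coherentState (u γ) p p * coherentState (v γ) j k ∂μ)
      (∫ γ, coherentState (v γ) j k ∂μ) := by
  refine hasSum_integral_of_dominated_convergence (fun p γ => ‖coherentState (u γ) p p‖)
    (fun p => ?_) (fun p => ae_of_all _ fun γ => ?_) (ae_of_all _ fun γ => ?_) ?_
    (ae_of_all _ fun γ => ?_)
  · exact (((continuous_coherentState p p).comp hu).mul
      ((continuous_coherentState j k).comp hv)).aestronglyMeasurable
  · rw [norm_mul]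
    exact mul_le_of_le_one_right (norm_nonneg _) (norm_coherentState_le_one _ _ _)
  · exact (hasSum_norm_coherentState_diag _).summable
  · simp only [(hasSum_norm_coherentState_diag _).tsum_eq]
    exact integrable_const _
  · simpa using (hasSum_coherentState_diag (u γ)).mul_right (coherentState (v γ) j k)

/-- For each fixed noise amplitude `γ` the two outputs are an uncorrelated pair of coherent states,
and the traced one has trace `1`. -/
theorem adversaryOutput_coherentState {η nB : ℝ} (hη : η ∈ Set.Ioo (0 : ℝ) 1) (hnB : 0 < nB)
    (α : ℂ) (j k : ℕ) :
    adversaryOutput η nB (coherentState α) j k =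
      ∫ γ, coherentState (Real.sqrt (1 - η) * α + Real.sqrt η * γ) j k ∂(complexGaussian nB) := by
  have := isProbabilityMeasure_complexGaussian hnB
  simp only [adversaryOutput, traceFst, Matrix.of_apply,
    beamsplitter_coherentState_thermalState hη hnB]
  exact (hasSum_integral_coherentState_diag_mul (by fun_prop) (by fun_prop) j k).tsum_eq

theorem sensorOutput_coherentState {η nB : ℝ} (hη : η ∈ Set.Ioo (0 : ℝ) 1) (hnB : 0 < nB)
    (θ : ℝ) (α : ℂ) (j k : ℕ) :
    sensorOutput η nB θ (coherentState α) j k =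
      ∫ γ, coherentState (Complex.exp (Complex.I * θ) *
        (Real.sqrt η * α - Real.sqrt (1 - η) * γ)) j k ∂(complexGaussian nB) := by
  have := isProbabilityMeasure_complexGaussian hnB
  have hc : ‖Complex.exp (Complex.I * θ)‖ = 1 := by
    rw [mul_comm]; exact Complex.norm_exp_ofReal_mul_I θ
  simp only [sensorOutput, phaseRotation, traceSnd, Matrix.of_apply,
    beamsplitter_coherentState_thermalState hη hnB]
  have h := (hasSum_integral_coherentState_diag_mul (μ := complexGaussian nB)
    (u := fun γ => Real.sqrt (1 - η) * α + Real.sqrt η * γ)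
    (v := fun γ => Real.sqrt η * α - Real.sqrt (1 - η) * γ) (by fun_prop) (by fun_prop) j k).tsum_eq
  simp only [mul_comm (coherentState (_ * α + _) _ _)] at h
  rw [h, ← integral_const_mul, ← integral_mul_const]
  congr 1
  ext γ
  rw [coherentState_unit_mul hc, ← map_pow, ← Complex.exp_nat_mul, ← Complex.exp_nat_mul,
    mul_comm (j : ℂ), mul_comm (k : ℂ)]

/-! ### The states of the adversary -/

theorem adversaryOutput_vacuum {η nB : ℝ} (hη : η ∈ Set.Ioo (0 : ℝ) 1) (hnB : 0 < nB) :
    adversaryOutput η nB (coherentState 0) = thermalState (η * nB) := by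
  ext j k
  have hr : (Real.sqrt η : ℂ) ≠ 0 := by
    rw [Complex.ofReal_ne_zero]; exact (Real.sqrt_pos.2 hη.1).ne'
  have hm := complexGaussian_map_mul hnB hr
  rw [Complex.norm_real, Real.norm_of_nonneg (Real.sqrt_nonneg _), Real.sq_sqrt hη.1.le,
    mul_comm] at hm
  rw [adversaryOutput_coherentState hη hnB, thermalState_eq_integral (mul_pos hη.1 hnB), ← hm,
    integral_map (by fun_prop) (continuous_coherentState j k).aestronglyMeasurable]
  simp

/-- The captured amplitude is a sum of two independent Gaussians, of variances `(1 - η) nS` and `η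
nB`; a Gaussian mixture of coherent states is thermal. -/
theorem integral_adversaryOutput {η nB nS : ℝ} (hη : η ∈ Set.Ioo (0 : ℝ) 1) (hnB : 0 < nB)
    (hnS : 0 < nS) (j k : ℕ) :
    ∫ α, adversaryOutput η nB (coherentState α) j k ∂(complexGaussian nS) =
      thermalState (η * nB + (1 - η) * nS) j k := by
  have h1 : 0 < 1 - η := by linarith [hη.2]
  have hr : (Real.sqrt η : ℂ) ≠ 0 := by
    rw [Complex.ofReal_ne_zero]; exact (Real.sqrt_pos.2 hη.1).ne'
  have hs : (Real.sqrt (1 - η) : ℂ) ≠ 0 := by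
    rw [Complex.ofReal_ne_zero]; exact (Real.sqrt_pos.2 h1).ne'
  have hB := complexGaussian_map_mul hnB hr
  have hS := complexGaussian_map_mul hnS hs
  rw [Complex.norm_real, Real.norm_of_nonneg (Real.sqrt_nonneg _), Real.sq_sqrt hη.1.le,
    mul_comm] at hB
  rw [Complex.norm_real, Real.norm_of_nonneg (Real.sqrt_nonneg _), Real.sq_sqrt h1.le,
    mul_comm] at hS
  have hB0 := mul_pos hη.1 hnB
  have hS0 := mul_pos h1 hnS
  have := isProbabilityMeasure_complexGaussian hnB
  have := isProbabilityMeasure_complexGaussian hB0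
  have := isProbabilityMeasure_complexGaussian hS0
  have hcont := continuous_coherentState j k
  rw [add_comm, thermalState_eq_integral (add_pos hS0 hB0), ← complexGaussian_conv hS0 hB0,
    integral_conv (integrable_of_continuous_of_norm_le hcont
      fun γ => norm_coherentState_le_one γ j k), ← hS, integral_map (by fun_prop) ?_]
  · congr 1
    ext α
    rw [adversaryOutput_coherentState hη hnB, ← hB, integral_map (by fun_prop)]
    exact (hcont.comp (by fun_prop)).aestronglyMeasurable
  · refine Continuous.aestronglyMeasurable ?_
    refine continuous_of_dominated (bound := fun _ => 1) (fun x => ?_)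
      (fun x => ae_of_all _ fun y => norm_coherentState_le_one _ j k) (integrable_const _)
      (ae_of_all _ fun y => hcont.comp (by fun_prop))
    exact (hcont.comp (by fun_prop)).aestronglyMeasurable

theorem adversaryIdle_eq {η nB : ℝ} (hη : η ∈ Set.Ioo (0 : ℝ) 1) (hnB : 0 < nB) (n : ℕ) :
    adversaryIdle η nB n = tensorState fun _ => thermalState (η * nB) := by
  rw [adversaryIdle, adversaryOutput_vacuum hη hnB]

theorem adversaryProbed_eq {η nB nS : ℝ} (hη : η ∈ Set.Ioo (0 : ℝ) 1) (hnB : 0 < nB)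
    (hnS : 0 < nS) (n : ℕ) :
    adversaryProbed η nB nS n =
      tensorState fun _ => thermalState (η * nB + (1 - η) * nS) := by
  have := isProbabilityMeasure_complexGaussian hnS
  ext k l
  simp only [adversaryProbed, tensorState, Matrix.of_apply, probeLaw]
  rw [integral_fintype_prod_eq_prod
    (f := fun i α => adversaryOutput η nB (coherentState α) (k i) (l i))]
  simp only [integral_adversaryOutput hη hnB hnS]

/-- Square root of the photon number distribution of `n` thermal modes. -/
noncomputable def sqrtThermalWeight (N : ℝ) {n : ℕ} (k : Fin n → ℕ) : ℝ :=
  ∏ i, Real.sqrt (N ^ k i / (1 + N) ^ (k i + 1))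

theorem tensorState_thermalState {N : ℝ} (hN : 0 < N) {n : ℕ} (k l : Fin n → ℕ) :
    tensorState (fun _ => thermalState N) k l =
      if k = l then ((sqrtThermalWeight N k ^ 2 : ℝ) : ℂ) else 0 := by
  simp only [tensorState, Matrix.of_apply, thermalState]
  split_ifs with h
  · subst h
    rw [sqrtThermalWeight, ← Finset.prod_pow, Complex.ofReal_prod]
    refine Finset.prod_congr rfl fun i _ => ?_
    rw [Matrix.diagonal_apply_eq, Real.sq_sqrt (by positivity)]
  · obtain ⟨i, hi⟩ := Function.ne_iff.1 h
    exact Finset.prod_eq_zero (Finset.mem_univ i) (Matrix.diagonal_apply_ne _ hi)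

theorem hasSum_prod_pow {f : ℕ → ℝ} (hf : ∀ k, 0 ≤ f k) {a : ℝ} (h : HasSum f a) (n : ℕ) :
    HasSum (fun k : Fin n → ℕ => ∏ i, f (k i)) (a ^ n) := by
  induction n with
  | zero =>
    simp only [Finset.univ_eq_empty, Finset.prod_empty, pow_zero]
    exact hasSum_unique (fun _ : Fin 0 → ℕ => (1 : ℝ))
  | succ n ih =>
    rw [← (Fin.consEquiv fun _ : Fin (n + 1) => ℕ).hasSum_iff, pow_succ']
    have hs := h.summable.mul_of_nonneg ih.summable hf
      fun k => Finset.prod_nonneg fun i _ => hf (k i)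
    have h2 := h.mul ih hs
    refine h2.congr_fun fun x => ?_
    simp [Fin.consEquiv, Fin.prod_univ_succ]

theorem hasSum_sqrt_thermal {M N : ℝ} (hM : 0 < M) (hN : 0 < N) :
    HasSum (fun k => Real.sqrt (M ^ k / (1 + M) ^ (k + 1)) * Real.sqrt (N ^ k / (1 + N) ^ (k + 1)))
      (1 / (Real.sqrt ((1 + M) * (1 + N)) - Real.sqrt (M * N))) := by
  set x := Real.sqrt (M * N) with hx
  set y := Real.sqrt ((1 + M) * (1 + N)) with hy
  have hx0 : 0 ≤ x := Real.sqrt_nonneg _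
  have hxy : x < y := Real.sqrt_lt_sqrt (by positivity) (by nlinarith)
  have hy0 : 0 < y := hx0.trans_lt hxy
  -- The summand is `x ^ k / y ^ (k + 1)`, a geometric sequence of ratio `x / y`.
  have h := (hasSum_geometric_of_lt_one (r := x / y) (by positivity)
    ((div_lt_one hy0).2 hxy)).mul_left (1 / y)
  have e : 1 / y * (1 - x / y)⁻¹ = 1 / (y - x) := by
    have : y - x ≠ 0 := (sub_pos.2 hxy).ne'
    field_simp
  rw [e] at h
  refine h.congr_fun fun k => ?_
  have hx2 : x ^ 2 = M * N := Real.sq_sqrt (by positivity)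
  have hy2 : y ^ 2 = (1 + M) * (1 + N) := Real.sq_sqrt (by positivity)
  rw [← Real.sqrt_mul (by positivity), div_mul_div_comm, ← mul_pow, ← mul_pow, ← hx2, ← hy2,
    show (x ^ 2) ^ k / (y ^ 2) ^ (k + 1) = (1 / y * (x / y) ^ k) ^ 2 by
      rw [div_pow]; field_simp; ring,
    Real.sqrt_sq (by positivity)]

theorem hasSum_sqrtThermalWeight_mul {M N : ℝ} (hM : 0 < M) (hN : 0 < N) (n : ℕ) :
    HasSum (fun k : Fin n → ℕ => sqrtThermalWeight M k * sqrtThermalWeight N k)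
      ((1 / (Real.sqrt ((1 + M) * (1 + N)) - Real.sqrt (M * N))) ^ n) := by
  have h := hasSum_prod_pow (fun k => by positivity) (hasSum_sqrt_thermal hM hN) n
  refine h.congr_fun fun k => ?_
  rw [sqrtThermalWeight, sqrtThermalWeight, Finset.prod_mul_distrib]

theorem hasSum_sqrtThermalWeight_sq {N : ℝ} (hN : 0 < N) (n : ℕ) :
    HasSum (fun k : Fin n → ℕ => sqrtThermalWeight N k ^ 2) 1 := by
  have h := hasSum_sqrtThermalWeight_mul hN hN n
  rw [Real.sqrt_mul_self (by positivity), Real.sqrt_mul_self hN.le, add_sub_cancel_right, div_one,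
    one_pow] at h
  simpa only [sq] using h

/-- The Bhattacharyya coefficient of two thermal states. -/
theorem one_sub_bhattacharyya_sq_le {N δ : ℝ} (hN : 0 < N) (hδ : 0 < δ) :
    1 - (1 / (Real.sqrt ((1 + N) * (1 + (N + δ))) - Real.sqrt (N * (N + δ)))) ^ 2 ≤
      δ ^ 2 / (4 * (N * (1 + N))) := by
  set N' := N + δ with hN'
  have hN'0 : 0 < N' := by positivity
  set x := Real.sqrt (N * (1 + N')) with hx
  set y := Real.sqrt (N' * (1 + N)) with hy
  set z := Real.sqrt (N * (1 + N)) with hz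
  set c := Real.sqrt ((1 + N) * (1 + N')) - Real.sqrt (N * N') with hc
  have hx2 : x ^ 2 = N * (1 + N') := Real.sq_sqrt (by positivity)
  have hy2 : y ^ 2 = N' * (1 + N) := Real.sq_sqrt (by positivity)
  have hz2 : z ^ 2 = N * (1 + N) := Real.sq_sqrt (by positivity)
  have hzx : z ≤ x := Real.sqrt_le_sqrt (by nlinarith)
  have hzy : z ≤ y := Real.sqrt_le_sqrt (by nlinarith)
  have hz0 : 0 < z := Real.sqrt_pos.2 (by positivity)
  have hxy : Real.sqrt ((1 + N) * (1 + N')) * Real.sqrt (N * N') = x * y := by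
    rw [hx, hy, ← Real.sqrt_mul (by positivity), ← Real.sqrt_mul (by positivity)]
    congr 1
    ring
  -- The squared coefficient is `1 / c ^ 2`, so `1 - 1 / c ^ 2` is at most `(y - x) ^ 2`. Since `(y
  -- - x) * (y + x) = δ` and `y + x ≥ 2 * z`, this is at most `δ ^ 2 / (4 * z ^ 2)`.
  have hc2 : c ^ 2 = 1 + (y - x) ^ 2 := by
    have e1 := Real.sq_sqrt (x := (1 + N) * (1 + N')) (by positivity)
    have e2 := Real.sq_sqrt (x := N * N') (by positivity)
    rw [hc]
    linear_combination e1 + e2 - 2 * hxy - hx2 - hy2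
  have hprod : (y - x) * (y + x) = δ := by
    linear_combination hy2 - hx2
  rw [div_pow, one_pow, hc2, le_div_iff₀ (by positivity)]
  have h1 : 1 - 1 / (1 + (y - x) ^ 2) ≤ (y - x) ^ 2 := by
    rw [sub_le_iff_le_add, ← sub_le_iff_le_add', le_div_iff₀ (by positivity)]
    nlinarith [sq_nonneg ((y - x) ^ 2)]
  have h2 : 4 * (N * (1 + N)) ≤ (y + x) ^ 2 := by
    rw [← hz2]
    nlinarith
  calc _ ≤ (y - x) ^ 2 * (y + x) ^ 2 := mul_le_mul h1 h2 (by positivity) (by positivity)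
    _ = δ ^ 2 := by rw [← mul_pow, hprod]

/-! ### Binary tests -/

/-- Two distributions `u ^ 2` and `v ^ 2` whose Bhattacharyya coefficient is close to `1` cannot be
told apart by a randomized test `e`. -/
theorem tsum_sq_sub_sq_mul_le {ι : Type*} {u v e : ι → ℝ} {b t : ℝ}
    (hu : HasSum (fun k => u k ^ 2) 1) (hv : HasSum (fun k => v k ^ 2) 1)
    (huv : HasSum (fun k => u k * v k) b) (ht : 0 < t) (hb0 : 0 < b) (hbt : 1 - b ^ 2 ≤ t ^ 2)
    (he : ∀ k, e k ∈ Set.Icc (0 : ℝ) 1) :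
    ∑' k, v k ^ 2 * e k - ∑' k, u k ^ 2 * e k ≤ t := by
  have hmul : ∀ {w : ι → ℝ}, HasSum (fun k => w k ^ 2) 1 → Summable fun k => w k ^ 2 * e k :=
    fun {w} hw => hw.summable.of_nonneg_of_le (fun k => mul_nonneg (sq_nonneg _) (he k).1)
      fun k => mul_le_of_le_one_right (sq_nonneg _) (he k).2
  -- Subtracting half of `v² - u²`, whose total is `0`, replaces `e` by `e - 1/2`, of modulus at
  -- most `1/2`. This gains a factor `2` over the bound `e ≤ 1`.
  have hsum : HasSum (fun k => (v k ^ 2 * e k - u k ^ 2 * e k) - (1 / 2) * (v k ^ 2 - u k ^ 2))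
      ((∑' k, v k ^ 2 * e k - ∑' k, u k ^ 2 * e k) - (1 / 2) * (1 - 1)) :=
    ((hmul hv).hasSum.sub (hmul hu).hasSum).sub ((hv.sub hu).mul_left _)
  -- Weight of the inequality `2 |v - u| |v + u| ≤ c (v - u)² + (v + u)² / c`, used in place of
  -- Cauchy–Schwarz. With this choice the total bound is `((1 - b²) / t + t) / 2`, which is at most
  -- `t`.
  set c := (1 + b) / t with hc
  have hc0 : 0 < c := by positivity
  have hbound : HasSum (fun k => (1 / 4) * (c * (v k ^ 2 + u k ^ 2 - 2 * (u k * v k)) +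
      1 / c * (v k ^ 2 + u k ^ 2 + 2 * (u k * v k))))
      ((1 / 4) * (c * (1 + 1 - 2 * b) + 1 / c * (1 + 1 + 2 * b))) :=
    ((((hv.add hu).sub (huv.mul_left 2)).mul_left c).add
      (((hv.add hu).add (huv.mul_left 2)).mul_left (1 / c))).mul_left _
  have hle := hasSum_le (fun k => ?_) hsum hbound
  · have e1 : (1 / 4) * (c * (1 + 1 - 2 * b) + 1 / c * (1 + 1 + 2 * b)) =
        (1 / 2) * ((1 - b ^ 2) / t + t) := by
      rw [hc]
      field_simp
      ring
    have e2 : (1 - b ^ 2) / t ≤ t := by rw [div_le_iff₀ ht]; linarith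
    rw [e1] at hle
    linarith
  · have e1 : (v k ^ 2 * e k - u k ^ 2 * e k) - (1 / 2) * (v k ^ 2 - u k ^ 2) ≤
        1 / 2 * |v k ^ 2 - u k ^ 2| := by
      rw [show (v k ^ 2 * e k - u k ^ 2 * e k) - (1 / 2) * (v k ^ 2 - u k ^ 2) =
        (e k - 1 / 2) * (v k ^ 2 - u k ^ 2) by ring]
      refine (le_abs_self _).trans ?_
      rw [abs_mul]
      refine mul_le_mul_of_nonneg_right ?_ (abs_nonneg _)
      rw [abs_le]
      constructor <;> linarith [(he k).1, (he k).2]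
    refine e1.trans ?_
    have e2 : |v k ^ 2 - u k ^ 2| = |v k - u k| * |v k + u k| := by
      rw [← abs_mul]; congr 1; ring
    have e3 : c * (v k ^ 2 + u k ^ 2 - 2 * (u k * v k)) + 1 / c * (v k ^ 2 + u k ^ 2 + 2 * (u k * v k))
        - 2 * (|v k - u k| * |v k + u k|) = (c * |v k - u k| - |v k + u k|) ^ 2 / c := by
      field_simp
      linear_combination (-c ^ 2) * sq_abs (v k - u k) - sq_abs (v k + u k)
    have e4 : 0 ≤ (c * |v k - u k| - |v k + u k|) ^ 2 / c := by positivity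
    rw [e2]
    linarith

theorem bornProb_tensorState_thermalState {N : ℝ} (hN : 0 < N) {n : ℕ}
    (E : FockSpace n →L[ℂ] FockSpace n) :
    bornProb (tensorState fun _ => thermalState N) E =
      (∑' k, ((sqrtThermalWeight N k ^ 2 : ℝ) : ℂ) *
        (E (lp.single 2 k 1) : FockSpace n) k).re := by
  rw [bornProb]
  congr 2
  ext k
  rw [tsum_eq_single k fun l hl => ?_]
  · rw [tensorState_thermalState hN, if_pos rfl]
  · rw [tensorState_thermalState hN, if_neg hl.symm, zero_mul]

open scoped ComplexOrder in
theorem diag_nonneg {n : ℕ} {E : FockSpace n →L[ℂ] FockSpace n} (hE : 0 ≤ E) (k : Fin n → ℕ) :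
    0 ≤ ((E (lp.single 2 k 1) : FockSpace n) k).re ∧
      ((E (lp.single 2 k 1) : FockSpace n) k).im = 0 := by
  have h := ((ContinuousLinearMap.nonneg_iff_isPositive E).1 hE).inner_nonneg_right
    (lp.single 2 k 1)
  rw [lp.inner_single_left] at h
  have h' := Complex.nonneg_iff.1 h
  simpa [eq_comm] using h'

theorem bornProb_eq_tsum {N : ℝ} (hN : 0 < N) {n : ℕ} {E : FockSpace n →L[ℂ] FockSpace n}
    (hE : 0 ≤ E) :
    bornProb (tensorState fun _ => thermalState N) E =
      ∑' k, sqrtThermalWeight N k ^ 2 * ((E (lp.single 2 k 1) : FockSpace n) k).re := by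
  have h : ∀ k, (E (lp.single 2 k 1) : FockSpace n) k =
      ((((E (lp.single 2 k 1) : FockSpace n) k).re : ℝ) : ℂ) := fun k => by
    apply Complex.ext
    · simp
    · rw [Complex.ofReal_im]
      exact (diag_nonneg hE k).2
  rw [bornProb_tensorState_thermalState hN]
  conv_lhs =>
    congr
    congr
    ext k
    rw [h k, ← Complex.ofReal_mul]
  rw [← Complex.ofReal_tsum, Complex.ofReal_re]

theorem detectionError_ge {η nB ε : ℝ} (hη : η ∈ Set.Ioo (0 : ℝ) 1) (hnB : 0 < nB) (hε : 0 < ε)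
    {n : ℕ} (hn : 1 ≤ n) {E : FockSpace n →L[ℂ] FockSpace n} (hE : 0 ≤ E) (hE1 : E ≤ 1) :
    1 / 2 - ε ≤ detectionError η nB (covertPhotonNumber η nB ε n) E := by
  have h1η : 0 < 1 - η := by linarith [hη.2]
  have hn0 : (0 : ℝ) < n := by exact_mod_cast hn
  set N := η * nB with hNdef
  have hN : 0 < N := mul_pos hη.1 hnB
  have hnS : 0 < covertPhotonNumber η nB ε n := by
    have := Real.sqrt_pos.2 (show 0 < η * nB * (1 + η * nB) by rw [← hNdef]; positivity)
    have := Real.sqrt_pos.2 hn0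
    unfold covertPhotonNumber
    positivity
  set δ := (1 - η) * covertPhotonNumber η nB ε n with hδdef
  have hδ : 0 < δ := mul_pos h1η hnS
  -- The photon number is calibrated for this identity: `n` times the single-mode bound on `1 - b²`
  -- equals `(2ε)²`.
  have hδ2 : n * (δ ^ 2 / (4 * (N * (1 + N)))) = (2 * ε) ^ 2 := by
    have e : δ = 4 * ε * Real.sqrt (N * (1 + N)) / Real.sqrt n := by
      rw [hδdef, covertPhotonNumber, ← hNdef]
      field_simp
    rw [e, div_pow, mul_pow, Real.sq_sqrt (by positivity), Real.sq_sqrt hn0.le]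
    field_simp
    ring
  have hNδ : 0 < N + δ := by positivity
  have hE' : 0 ≤ 1 - E := sub_nonneg.2 hE1
  have hdiag : ∀ k, ((1 - E) (lp.single 2 k 1) : FockSpace n) k =
      1 - (E (lp.single 2 k 1) : FockSpace n) k := fun k => by
    simp
  set e : (Fin n → ℕ) → ℝ := fun k => ((E (lp.single 2 k 1) : FockSpace n) k).re with hedef
  have he : ∀ k, e k ∈ Set.Icc (0 : ℝ) 1 := fun k => by
    refine ⟨(diag_nonneg hE k).1, ?_⟩
    have := (diag_nonneg hE' k).1
    rw [hdiag, Complex.sub_re, Complex.one_re] at this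
    linarith
  rw [detectionError, adversaryIdle_eq hη hnB, adversaryProbed_eq hη hnB hnS, ← hNdef, ← hδdef,
    bornProb_eq_tsum hN hE, bornProb_eq_tsum hNδ hE']
  simp only [hdiag, Complex.sub_re, Complex.one_re]
  have hv := hasSum_sqrtThermalWeight_sq hNδ n
  have hve : Summable fun k => sqrtThermalWeight (N + δ) k ^ 2 * e k :=
    hv.summable.of_nonneg_of_le (fun k => mul_nonneg (sq_nonneg _) (he k).1)
      fun k => mul_le_of_le_one_right (sq_nonneg _) (he k).2
  have hsplit : ∑' k, sqrtThermalWeight (N + δ) k ^ 2 * (1 - e k) =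
      1 - ∑' k, sqrtThermalWeight (N + δ) k ^ 2 * e k := by
    simp only [mul_sub, mul_one]
    rw [hv.summable.tsum_sub hve, hv.tsum_eq]
  set c := Real.sqrt ((1 + N) * (1 + (N + δ))) - Real.sqrt (N * (N + δ)) with hcdef
  have hc : 0 < c := sub_pos.2 (Real.sqrt_lt_sqrt (by positivity) (by nlinarith))
  have hb : 1 - ((1 / c) ^ n) ^ 2 ≤ (2 * ε) ^ 2 := by
    have h1 := one_sub_bhattacharyya_sq_le hN hδ
    rw [← hcdef] at h1
    -- Bernoulli's inequality bounds the loss of the `n`-mode squared coefficient by `n` times the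
    -- single-mode loss.
    have h2 := one_add_mul_le_pow (a := (1 / c) ^ 2 - 1) (by linarith [sq_nonneg (1 / c)]) n
    rw [add_sub_cancel, ← pow_mul, mul_comm 2 n, pow_mul] at h2
    have h3 := mul_le_mul_of_nonneg_left h1 hn0.le
    rw [hδ2] at h3
    linarith
  have hmain := tsum_sq_sub_sq_mul_le (hasSum_sqrtThermalWeight_sq hN n) hv
    (hasSum_sqrtThermalWeight_mul hN hNδ n) (by positivity : 0 < 2 * ε) (by positivity) hb he
  change 1 / 2 - ε ≤ (∑' k, sqrtThermalWeight N k ^ 2 * e k +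
    ∑' k, sqrtThermalWeight (N + δ) k ^ 2 * (1 - e k)) / 2
  rw [hsplit]
  linarith

/-! ### Heterodyne detection -/

theorem norm_tsum_conj_coherentAmp_le_one (α β : ℂ) :
    ‖Complex.exp (-(‖α‖ ^ 2 / 2 : ℝ) - (‖β‖ ^ 2 / 2 : ℝ) + conj α * β)‖ ≤ 1 := by
  refine ((hasSum_conj_coherentAmp_mul α β).norm_le_of_bounded
    (hasSum_norm_coherentAmp_mul α β) fun k => ?_).trans ?_
  · rw [norm_mul, RCLike.norm_conj]
  · rw [Real.exp_le_one_iff]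
    have := sq_nonneg (‖α‖ - ‖β‖)
    linarith

/-- The two factors are `⟨β|α⟩` and `⟨α|β⟩`; their product is the Husimi function of a coherent
state. -/
theorem overlap_mul_overlap (α β : ℂ) :
    Complex.exp (-(‖β‖ ^ 2 / 2 : ℝ) - (‖α‖ ^ 2 / 2 : ℝ) + conj β * α) *
      Complex.exp (-(‖α‖ ^ 2 / 2 : ℝ) - (‖β‖ ^ 2 / 2 : ℝ) + conj α * β) =
      ((Real.exp (-‖β - α‖ ^ 2) : ℝ) : ℂ) := by
  rw [← Complex.exp_add, Complex.ofReal_exp]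
  congr 1
  have h : ((‖β - α‖ ^ 2 : ℝ) : ℂ) = (β - α) * conj (β - α) := by
    rw [Complex.mul_conj, Complex.normSq_eq_norm_sq]
  have h1 : ((‖β‖ ^ 2 : ℝ) : ℂ) = β * conj β := by
    rw [Complex.mul_conj, Complex.normSq_eq_norm_sq]
  have h2 : ((‖α‖ ^ 2 : ℝ) : ℂ) = α * conj α := by
    rw [Complex.mul_conj, Complex.normSq_eq_norm_sq]
  rw [Complex.ofReal_neg, Complex.ofReal_div, Complex.ofReal_div, h, h1, h2, map_sub,
    Complex.ofReal_ofNat]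
  ring

/-- Heterodyne detection of a mixture of coherent states. -/
theorem heterodyneDensity_of_mixture {μ : Measure ℂ} [IsProbabilityMeasure μ] {u : ℂ → ℂ}
    (hu : Continuous u) {ρ : Matrix ℕ ℕ ℂ} (hρ : ∀ j k, ρ j k = ∫ γ, coherentState (u γ) j k ∂μ)
    (β : ℂ) :
    heterodyneDensity ρ β = (∫ γ, Real.exp (-‖β - u γ‖ ^ 2) ∂μ) / Real.pi := by
  have hamp : ∀ k, Continuous fun γ => coherentAmp (u γ) k := fun k =>
    (continuous_coherentAmp k).comp hu
  have hov : Continuous fun γ => Complex.exp (-(‖u γ‖ ^ 2 / 2 : ℝ) - (‖β‖ ^ 2 / 2 : ℝ) +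
      conj (u γ) * β) := by fun_prop
  -- The inner sum yields the overlap `⟨u γ|β⟩`, of modulus at most `1`; the outer sum can then be
  -- dominated in the same way.
  have hinner : ∀ j, ∑' k, conj (coherentAmp β j) * ρ j k * coherentAmp β k =
      ∫ γ, conj (coherentAmp β j) * coherentAmp (u γ) j *
        Complex.exp (-(‖u γ‖ ^ 2 / 2 : ℝ) - (‖β‖ ^ 2 / 2 : ℝ) + conj (u γ) * β) ∂μ := by
    intro j
    have h : HasSum (fun k => ∫ γ, conj (coherentAmp β j) * coherentState (u γ) j k *
        coherentAmp β k ∂μ) (∫ γ, conj (coherentAmp β j) * coherentAmp (u γ) j *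
        Complex.exp (-(‖u γ‖ ^ 2 / 2 : ℝ) - (‖β‖ ^ 2 / 2 : ℝ) + conj (u γ) * β) ∂μ) := by
      refine hasSum_integral_of_dominated_convergence
        (fun k γ => ‖coherentAmp (u γ) k‖ * ‖coherentAmp β k‖)
        (fun k => ?_) (fun k => ae_of_all _ fun γ => ?_) (ae_of_all _ fun γ => ?_) ?_
        (ae_of_all _ fun γ => ?_)
      · exact ((continuous_const.mul ((continuous_coherentState j k).comp hu)).mul
          continuous_const).aestronglyMeasurable
      · rw [coherentState, Matrix.of_apply, norm_mul, norm_mul, norm_mul, RCLike.norm_conj,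
          RCLike.norm_conj, ← mul_assoc]
        refine mul_le_mul_of_nonneg_right ?_ (norm_nonneg _)
        exact mul_le_of_le_one_left (norm_nonneg _)
          (mul_le_one₀ (norm_coherentAmp_le_one _ _) (norm_nonneg _) (norm_coherentAmp_le_one _ _))
      · exact (hasSum_norm_coherentAmp_mul _ _).summable
      · simp only [(hasSum_norm_coherentAmp_mul _ _).tsum_eq]
        refine Integrable.of_bound (C := 1) (by fun_prop) (ae_of_all _ fun γ => ?_)
        rw [Real.norm_of_nonneg (Real.exp_nonneg _), Real.exp_le_one_iff]
        have := sq_nonneg (‖u γ‖ - ‖β‖)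
        linarith
      · refine ((hasSum_conj_coherentAmp_mul (u γ) β).mul_left
          (conj (coherentAmp β j) * coherentAmp (u γ) j)).congr_fun fun k => ?_
        rw [coherentState, Matrix.of_apply]
        ring
    rw [← h.tsum_eq]
    congr 1
    ext k
    rw [integral_mul_const, integral_const_mul, hρ]
  have houter : HasSum (fun j => ∫ γ, conj (coherentAmp β j) * coherentAmp (u γ) j *
      Complex.exp (-(‖u γ‖ ^ 2 / 2 : ℝ) - (‖β‖ ^ 2 / 2 : ℝ) + conj (u γ) * β) ∂μ)
      (∫ γ, ((Real.exp (-‖β - u γ‖ ^ 2) : ℝ) : ℂ) ∂μ) := by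
    refine hasSum_integral_of_dominated_convergence
      (fun j γ => ‖coherentAmp β j‖ * ‖coherentAmp (u γ) j‖)
      (fun j => ?_) (fun j => ae_of_all _ fun γ => ?_) (ae_of_all _ fun γ => ?_) ?_
      (ae_of_all _ fun γ => ?_)
    · exact ((continuous_const.mul (hamp j)).mul hov).aestronglyMeasurable
    · rw [norm_mul, norm_mul, RCLike.norm_conj]
      exact mul_le_of_le_one_right (by positivity) (norm_tsum_conj_coherentAmp_le_one _ _)
    · exact (hasSum_norm_coherentAmp_mul _ _).summable
    · simp only [(hasSum_norm_coherentAmp_mul _ _).tsum_eq]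
      refine Integrable.of_bound (C := 1) (by fun_prop) (ae_of_all _ fun γ => ?_)
      rw [Real.norm_of_nonneg (Real.exp_nonneg _), Real.exp_le_one_iff]
      have := sq_nonneg (‖β‖ - ‖u γ‖)
      linarith
    · rw [← overlap_mul_overlap]
      exact (hasSum_conj_coherentAmp_mul β (u γ)).mul_right _
  rw [heterodyneDensity]
  simp only [hinner]
  rw [houter.tsum_eq, integral_complex_ofReal, Complex.ofReal_re]

/-- The density is the average over `μ` of unit Gaussian densities centred at `u γ`. Ideal
heterodyning thus adds independent vacuum noise of variance `1` to the classical amplitude. -/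
theorem heterodyneLaw_of_mixture {μ : Measure ℂ} [IsProbabilityMeasure μ] {u : ℂ → ℂ}
    (hu : Continuous u) {ρ : Matrix ℕ ℕ ℂ}
    (hρ : ∀ j k, ρ j k = ∫ γ, coherentState (u γ) j k ∂μ) :
    heterodyneLaw ρ = (μ.map u).conv (complexGaussian 1) := by
  have := isProbabilityMeasure_complexGaussian one_pos
  set d : ℂ → ENNReal := fun z => ENNReal.ofReal (Real.exp (-‖z‖ ^ 2 / 1) / (Real.pi * 1)) with hd
  have hdm : Measurable d := by fun_prop
  have hum : Measurable u := hu.measurable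
  have hdens : ∀ β, ENNReal.ofReal (heterodyneDensity ρ β) = ∫⁻ γ, d (β - u γ) ∂μ := by
    intro β
    rw [heterodyneDensity_of_mixture hu hρ, ← integral_div,
      ofReal_integral_eq_lintegral_ofReal]
    · simp only [hd, div_one, mul_one]
    · refine Integrable.of_bound (C := 1 / Real.pi) (by fun_prop) (ae_of_all _ fun γ => ?_)
      rw [Real.norm_of_nonneg (by positivity)]
      refine div_le_div_of_nonneg_right ?_ Real.pi_pos.le
      rw [Real.exp_le_one_iff]
      have := sq_nonneg ‖β - u γ‖
      linarith
    · exact ae_of_all _ fun γ => by positivity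
  refine Measure.ext_of_lintegral _ fun f hf => ?_
  have hjoint : Measurable fun p : ℂ × ℂ => d (p.1 - u p.2) := by fun_prop
  rw [heterodyneLaw]
  simp only [hdens]
  rw [lintegral_withDensity_eq_lintegral_mul _ hjoint.lintegral_prod_right' hf,
    Measure.lintegral_conv hf, lintegral_map ?_ hum]
  · simp only [Pi.mul_apply]
    calc ∫⁻ β, (∫⁻ γ, d (β - u γ) ∂μ) * f β
        = ∫⁻ β, ∫⁻ γ, d (β - u γ) * f β ∂μ := by
          congr 1
          ext β
          rw [lintegral_mul_const _ (by fun_prop)]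
      _ = ∫⁻ γ, ∫⁻ β, d (β - u γ) * f β ∂volume ∂μ :=
          lintegral_lintegral_swap (by fun_prop)
      _ = _ := by
          congr 1
          ext γ
          rw [← lintegral_add_left_eq_self _ (u γ), complexGaussian,
            lintegral_withDensity_eq_lintegral_mul _ hdm (by fun_prop)]
          simp only [add_sub_cancel_left, Pi.mul_apply]
  · have : Measurable fun p : ℂ × ℂ => f (p.1 + p.2) := by fun_prop
    exact this.lintegral_prod_right'

theorem norm_exp_I_mul (θ : ℝ) : ‖Complex.exp (Complex.I * θ)‖ = 1 := by
  rw [mul_comm]; exact Complex.norm_exp_ofReal_mul_I θ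

/-- In the variance, `1` is the heterodyne vacuum noise and `nB * (1 - η)` the thermal noise
transmitted to the sensor. The phase rotates the thermal noise too, but its law is isotropic. -/
theorem heterodyneLaw_sensorOutput {η nB : ℝ} (hη : η ∈ Set.Ioo (0 : ℝ) 1) (hnB : 0 < nB)
    (θ : ℝ) (α : ℂ) :
    heterodyneLaw (sensorOutput η nB θ (coherentState α)) =
      (complexGaussian (1 + nB * (1 - η))).map
        fun z => Complex.exp (Complex.I * θ) * (Real.sqrt η * α) + 1 * z := by
  have h1η : 0 < 1 - η := by linarith [hη.2]
  have hV : 0 < 1 + nB * (1 - η) := by positivity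
  have := isProbabilityMeasure_complexGaussian hnB
  have := isProbabilityMeasure_complexGaussian hV
  have := isProbabilityMeasure_complexGaussian one_pos
  rw [heterodyneLaw_of_mixture (by fun_prop) (sensorOutput_coherentState hη hnB θ α)]
  have e : (fun γ : ℂ => Complex.exp (Complex.I * θ) *
      (Real.sqrt η * α - Real.sqrt (1 - η) * γ)) = fun γ =>
      Complex.exp (Complex.I * θ) * (Real.sqrt η * α) +
        (-(Complex.exp (Complex.I * θ) * Real.sqrt (1 - η))) * γ := by
    ext γ; ring
  rw [e]
  have := Measure.isProbabilityMeasure_map (μ := complexGaussian nB)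
    (f := fun γ => Complex.exp (Complex.I * θ) * (Real.sqrt η * α) +
        (-(Complex.exp (Complex.I * θ) * Real.sqrt (1 - η))) * γ) (by fun_prop)
  have := Measure.isProbabilityMeasure_map (μ := complexGaussian (1 + nB * (1 - η)))
    (f := fun z => Complex.exp (Complex.I * θ) * (Real.sqrt η * α) + 1 * z) (by fun_prop)
  apply Measure.ext_of_charFun
  ext t
  rw [charFun_conv, charFun_map_affine_complexGaussian hnB, charFun_map_affine_complexGaussian hV,
    charFun_complexGaussian one_pos, ← Complex.exp_add, norm_neg, norm_mul, norm_exp_I_mul,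
    Complex.norm_real, Real.norm_of_nonneg (Real.sqrt_nonneg _), one_mul, Real.sq_sqrt h1η.le,
    norm_one]
  congr 1
  push_cast
  ring

/-- Law of the matched-filter statistic `∑ conj (α i) * x i`. -/
theorem readingLaw_map_sum {η nB : ℝ} (hη : η ∈ Set.Ioo (0 : ℝ) 1) (hnB : 0 < nB)
    (θ : ℝ) {n : ℕ} (α : Fin n → ℂ) :
    (readingLaw η nB θ α).map (fun x => ∑ i, conj (α i) * x i) =
      (complexGaussian 1).map fun w =>
        Complex.exp (Complex.I * θ) * (Real.sqrt η * (∑ i, ‖α i‖ ^ 2 : ℝ)) +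
          Complex.exp (Complex.I * θ) *
            Real.sqrt ((1 + nB * (1 - η)) * ∑ i, ‖α i‖ ^ 2) * w := by
  have h1η : 0 < 1 - η := by linarith [hη.2]
  have hV : 0 < 1 + nB * (1 - η) := by positivity
  have := isProbabilityMeasure_complexGaussian hV
  have := isProbabilityMeasure_complexGaussian one_pos
  have hp : ∀ i, IsProbabilityMeasure
      (heterodyneLaw (sensorOutput η nB θ (coherentState (α i)))) := fun i => by
    rw [heterodyneLaw_sensorOutput hη hnB]
    exact Measure.isProbabilityMeasure_map (by fun_prop)
  have hm : Measurable fun x : Fin n → ℂ => ∑ i, conj (α i) * x i :=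
    Finset.measurable_sum _ fun i _ => (measurable_pi_apply i).const_mul _
  obtain ⟨A, hA⟩ : ∃ A, A = ∑ i, ‖α i‖ ^ 2 := ⟨_, rfl⟩
  have hA0 : 0 ≤ A := hA ▸ Finset.sum_nonneg fun i _ => by positivity
  rw [readingLaw, ← hA]
  have := Measure.isProbabilityMeasure_map
    (μ := Measure.pi fun i => heterodyneLaw (sensorOutput η nB θ (coherentState (α i))))
    hm.aemeasurable
  have := Measure.isProbabilityMeasure_map (μ := complexGaussian 1)
    (f := fun w => Complex.exp (Complex.I * θ) * (Real.sqrt η * (A : ℝ)) +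
          Complex.exp (Complex.I * θ) * Real.sqrt ((1 + nB * (1 - η)) * A) * w) (by fun_prop)
  apply Measure.ext_of_charFun
  ext t
  rw [charFun_map_affine_complexGaussian one_pos, charFun_apply,
    integral_map hm.aemeasurable (by fun_prop)]
  simp only [sum_inner, inner_mul_left_complex (conj _), RCLike.conj_conj, Complex.ofReal_sum,
    Finset.sum_mul, Complex.exp_sum]
  -- By independence the characteristic function of the statistic at `t` is the product of those of
  -- the readings at `α i * t`.
  rw [integral_fintype_prod_eq_prod
    (f := fun i x => Complex.exp ((inner ℝ x (α i * t) : ℝ) * Complex.I))]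
  simp only [← charFun_apply]
  simp only [heterodyneLaw_sensorOutput hη hnB, charFun_map_affine_complexGaussian hV]
  rw [← Complex.exp_sum, Finset.sum_sub_distrib, ← Finset.sum_mul]
  congr 2
  · congr 1
    rw [← Complex.ofReal_sum]
    congr 1
    have : ∀ i, inner ℝ (Complex.exp (Complex.I * θ) * (Real.sqrt η * α i)) (α i * t) =
        Real.sqrt η * ‖α i‖ ^ 2 * inner ℝ (Complex.exp (Complex.I * θ)) t := fun i => by
      rw [Complex.inner, Complex.inner, ← Complex.normSq_eq_norm_sq, ← Complex.re_ofReal_mul]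
      congr 1
      push_cast
      rw [← Complex.mul_conj]
      simp only [map_mul, Complex.conj_ofReal]
      ring
    simp only [this]
    rw [← Finset.sum_mul, ← Finset.mul_sum, ← hA]
    rw [Complex.inner, Complex.inner, ← Complex.re_ofReal_mul]
    congr 1
    push_cast
    simp only [map_mul, Complex.conj_ofReal]
    ring
  · rw [← Complex.ofReal_sum]
    congr 1
    rw [norm_mul (Complex.exp _), norm_exp_I_mul, Complex.norm_real,
      Real.norm_of_nonneg (Real.sqrt_nonneg _), one_mul, one_mul, Real.sq_sqrt (by positivity)]
    simp only [norm_mul, norm_one, mul_pow]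
    rw [hA, Finset.mul_sum, Finset.sum_mul, Finset.sum_div]
    refine Finset.sum_congr rfl fun i _ => ?_
    ring

/-! ### The error of the arctangent estimator -/

/-- Error of the arctangent estimate of `θ` obtained from `exp (i θ) (1 + u)`. -/
noncomputable def phaseError (θ : ℝ) (u : ℂ) : ℝ :=
  θ - Real.arctan ((Complex.exp (Complex.I * θ) * (1 + u)).im /
    (Complex.exp (Complex.I * θ) * (1 + u)).re)

theorem measurable_phaseError (θ : ℝ) : Measurable (phaseError θ) := by
  unfold phaseError
  refine measurable_const.sub (Real.measurable_arctan.comp ?_)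
  exact (Complex.measurable_im.comp (by fun_prop)).div (Complex.measurable_re.comp (by fun_prop))

theorem exp_I_mul_mul_re (θ : ℝ) (z : ℂ) :
    (Complex.exp (Complex.I * θ) * z).re = Real.cos θ * z.re - Real.sin θ * z.im := by
  rw [mul_comm Complex.I, Complex.mul_re, Complex.exp_ofReal_mul_I_re, Complex.exp_ofReal_mul_I_im]

theorem exp_I_mul_mul_im (θ : ℝ) (z : ℂ) :
    (Complex.exp (Complex.I * θ) * z).im = Real.cos θ * z.im + Real.sin θ * z.re := by
  rw [mul_comm Complex.I, Complex.mul_im, Complex.exp_ofReal_mul_I_re, Complex.exp_ofReal_mul_I_im]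

theorem abs_sub_arctan_le {θ : ℝ} (hθ : θ ∈ Set.Ioo (-(Real.pi / 2)) (Real.pi / 2)) (y : ℝ) :
    |θ - Real.arctan y| ≤ Real.pi := by
  rw [abs_le]
  constructor <;> linarith [hθ.1, hθ.2, Real.neg_pi_div_two_lt_arctan y, Real.arctan_lt_pi_div_two y]

theorem abs_arctan_sub_arctan_le (x y : ℝ) : |Real.arctan x - Real.arctan y| ≤ |x - y| := by
  have h := Convex.norm_image_sub_le_of_norm_deriv_le (f := Real.arctan) (C := 1) (s := Set.univ)
    (x := y) (y := x) (fun z _ => Real.differentiable_arctan z) (fun z _ => ?_) convex_univ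
    (Set.mem_univ _) (Set.mem_univ _)
  · simpa using h
  · rw [Real.deriv_arctan, Real.norm_of_nonneg (by positivity), div_le_one (by positivity)]
    nlinarith [sq_nonneg z]

/-- A bound linear in the noise for all `u`, needed for domination. If `‖u‖ ≥ cos θ / 2`, the
trivial bound `π` suffices. Otherwise the real part stays above `cos θ / 2`, and `arctan` being
1-Lipschitz gives `2 ‖u‖ / cos² θ`. -/
theorem abs_phaseError_le {θ : ℝ} (hθ : θ ∈ Set.Ioo (-(Real.pi / 2)) (Real.pi / 2)) (u : ℂ) :
    |phaseError θ u| ≤ 2 * Real.pi / Real.cos θ ^ 2 * ‖u‖ := by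
  have hc : 0 < Real.cos θ := Real.cos_pos_of_mem_Ioo hθ
  have hc1 : Real.cos θ ≤ 1 := Real.cos_le_one θ
  have hpi := Real.pi_gt_three
  have hu0 := norm_nonneg u
  rw [div_mul_eq_mul_div, le_div_iff₀ (by positivity)]
  by_cases h : Real.cos θ / 2 ≤ ‖u‖
  · calc |phaseError θ u| * Real.cos θ ^ 2 ≤ Real.pi * Real.cos θ ^ 2 :=
          mul_le_mul_of_nonneg_right (abs_sub_arctan_le hθ _) (by positivity)
      _ ≤ Real.pi * Real.cos θ := by nlinarith [mul_pos Real.pi_pos hc]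
      _ ≤ 2 * Real.pi * ‖u‖ := by nlinarith [Real.pi_pos]
  · push Not at h
    set re := (Complex.exp (Complex.I * θ) * (1 + u)).re with hre
    set im := (Complex.exp (Complex.I * θ) * (1 + u)).im with him
    have hre' : re = Real.cos θ + (Complex.exp (Complex.I * θ) * u).re := by
      rw [hre, exp_I_mul_mul_re, exp_I_mul_mul_re]
      simp
      ring
    have hbound : |(Complex.exp (Complex.I * θ) * u).re| ≤ ‖u‖ := by
      refine (Complex.abs_re_le_norm _).trans ?_
      rw [norm_mul, norm_exp_I_mul, one_mul]
    have hrepos : Real.cos θ / 2 ≤ re := by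
      rw [hre']
      linarith [(abs_le.1 hbound).1]
    have hre0 : 0 < re := by linarith
    -- Cross product with the direction `exp (iθ)`: only the noise component orthogonal to the
    -- signal survives.
    have hid : im * Real.cos θ - re * Real.sin θ = u.im := by
      rw [hre, him, exp_I_mul_mul_re, exp_I_mul_mul_im]
      simp
      linear_combination u.im * Real.sin_sq_add_cos_sq θ
    have h1 : |phaseError θ u| ≤ |Real.tan θ - im / re| := by
      have := abs_arctan_sub_arctan_le (Real.tan θ) (im / re)
      rwa [Real.arctan_tan hθ.1 hθ.2] at this
    have h2 : Real.tan θ - im / re = -u.im / (re * Real.cos θ) := by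
      rw [Real.tan_eq_sin_div_cos, ← hid]
      field_simp
      ring
    rw [h2, abs_div, abs_neg, abs_of_pos (by positivity : 0 < re * Real.cos θ)] at h1
    have h3 : |u.im| ≤ ‖u‖ := Complex.abs_im_le_norm u
    calc |phaseError θ u| * Real.cos θ ^ 2 ≤ |u.im| / (re * Real.cos θ) * Real.cos θ ^ 2 :=
          mul_le_mul_of_nonneg_right h1 (by positivity)
      _ = |u.im| * (Real.cos θ / re) := by field_simp
      _ ≤ ‖u‖ * 2 := by
          refine mul_le_mul h3 ?_ (by positivity) hu0
          rw [div_le_iff₀ hre0]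
          linarith
      _ ≤ 2 * Real.pi * ‖u‖ := by nlinarith

theorem hasDerivAt_phaseError {θ : ℝ} (hθ : θ ∈ Set.Ioo (-(Real.pi / 2)) (Real.pi / 2)) (w : ℂ) :
    HasDerivAt (fun s : ℝ => phaseError θ (s * w)) (-w.im) 0 := by
  have hc : 0 < Real.cos θ := Real.cos_pos_of_mem_Ioo hθ
  set a := Real.cos θ * w.re - Real.sin θ * w.im with ha
  set b := Real.cos θ * w.im + Real.sin θ * w.re with hb
  have e : (fun s : ℝ => phaseError θ (s * w)) = fun s =>
      θ - Real.arctan ((Real.sin θ + s * b) / (Real.cos θ + s * a)) := by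
    ext s
    rw [phaseError, exp_I_mul_mul_re, exp_I_mul_mul_im]
    simp only [Complex.add_re, Complex.add_im, Complex.one_re, Complex.one_im,
      Complex.re_ofReal_mul, Complex.im_ofReal_mul, ha, hb]
    congr 3 <;> ring
  rw [e]
  have hnum : HasDerivAt (fun s : ℝ => Real.sin θ + s * b) b 0 := by
    simpa using ((hasDerivAt_id (0 : ℝ)).mul_const b).const_add (Real.sin θ)
  have hden : HasDerivAt (fun s : ℝ => Real.cos θ + s * a) a 0 := by
    simpa using ((hasDerivAt_id (0 : ℝ)).mul_const a).const_add (Real.cos θ)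
  have h := ((hnum.div hden (by simpa using hc.ne')).arctan).const_sub θ
  refine h.congr_deriv ?_
  simp only [Pi.div_apply, zero_mul, add_zero]
  have hpos : 0 < Real.cos θ ^ 2 + Real.sin θ ^ 2 := by positivity
  rw [div_pow]
  field_simp
  rw [ha, hb]
  ring

/-- Mean squared error of the arctangent estimate at noise-to-signal ratio `t`. -/
noncomputable def noisyPhaseError (θ t : ℝ) : ℝ :=
  ∫ w, phaseError θ (Real.sqrt t * w) ^ 2 ∂(complexGaussian 1)

/-- Multiplication by `i` preserves the law, so the real and imaginary parts share the second moment
`1` equally. -/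
theorem integral_im_sq_complexGaussian :
    ∫ w, w.im ^ 2 ∂(complexGaussian 1) = 1 / 2 := by
  have hI : ‖Complex.I‖ = 1 := Complex.norm_I
  have hm := complexGaussian_map_mul one_pos Complex.I_ne_zero
  rw [hI, one_pow, mul_one] at hm
  have hnorm := integral_norm_pow_complexGaussian one_pos 1
  have hint := integrable_norm_pow_complexGaussian one_pos 1
  simp only [mul_one, Nat.factorial_one, Nat.cast_one, one_pow] at hnorm hint
  have him : Integrable (fun w : ℂ => w.im ^ 2) (complexGaussian 1) := by
    refine hint.mono' (by fun_prop) (ae_of_all _ fun w => ?_)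
    rw [Real.norm_of_nonneg (sq_nonneg _), ← sq_abs]
    exact pow_le_pow_left₀ (abs_nonneg _) (Complex.abs_im_le_norm w) 2
  have hre : Integrable (fun w : ℂ => w.re ^ 2) (complexGaussian 1) := by
    refine hint.mono' (by fun_prop) (ae_of_all _ fun w => ?_)
    rw [Real.norm_of_nonneg (sq_nonneg _), ← sq_abs]
    exact pow_le_pow_left₀ (abs_nonneg _) (Complex.abs_re_le_norm w) 2
  have heq : ∫ w, w.im ^ 2 ∂(complexGaussian 1) = ∫ w, w.re ^ 2 ∂(complexGaussian 1) := by
    conv_lhs => rw [← hm]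
    rw [integral_map (by fun_prop) (by fun_prop)]
    simp
  have hsum : ∫ w, w.re ^ 2 ∂(complexGaussian 1) + ∫ w, w.im ^ 2 ∂(complexGaussian 1) = 1 := by
    rw [← integral_add hre him]
    refine Eq.trans ?_ hnorm
    congr 1
    ext w
    rw [← Complex.normSq_eq_norm_sq, Complex.normSq_apply]
    ring
  linarith

/-- Dominated convergence: the squared difference quotient at step `√t` tends to `(Im w)²` and is
bounded by `K² ‖w‖²`. -/
theorem tendsto_noisyPhaseError_div {θ : ℝ} (hθ : θ ∈ Set.Ioo (-(Real.pi / 2)) (Real.pi / 2)) :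
    Tendsto (fun t => noisyPhaseError θ t / t) (nhdsWithin 0 (Set.Ioi 0)) (nhds (1 / 2)) := by
  rw [← integral_im_sq_complexGaussian]
  simp only [noisyPhaseError, ← integral_div]
  set K := 2 * Real.pi / Real.cos θ ^ 2 with hK
  refine tendsto_integral_filter_of_dominated_convergence (fun w => K ^ 2 * ‖w‖ ^ (2 * 1))
    (Eventually.of_forall fun t => ?_) ?_ ((integrable_norm_pow_complexGaussian one_pos 1).const_mul _)
    (ae_of_all _ fun w => ?_)
  · exact ((((measurable_phaseError θ).comp (by fun_prop)).pow_const 2).div_const t).aestronglyMeasurable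
  · filter_upwards [self_mem_nhdsWithin] with t ht
    have ht0 : 0 < t := ht
    refine ae_of_all _ fun w => ?_
    have h := abs_phaseError_le hθ (Real.sqrt t * w)
    rw [norm_mul, Complex.norm_real, Real.norm_of_nonneg (Real.sqrt_nonneg _), ← hK] at h
    rw [Real.norm_of_nonneg (by positivity), div_le_iff₀ ht0, ← sq_abs]
    refine (pow_le_pow_left₀ (abs_nonneg _) h 2).trans (le_of_eq ?_)
    rw [mul_pow, mul_pow, Real.sq_sqrt ht0.le]
    ring
  · have hd := hasDerivAt_phaseError hθ w
    rw [hasDerivAt_iff_tendsto_slope] at hd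
    have hs : Tendsto Real.sqrt (nhdsWithin 0 (Set.Ioi 0)) (nhdsWithin 0 {0}ᶜ) := by
      rw [tendsto_nhdsWithin_iff]
      refine ⟨?_, ?_⟩
      · have := Real.continuous_sqrt.tendsto 0
        rw [Real.sqrt_zero] at this
        exact this.mono_left nhdsWithin_le_nhds
      · filter_upwards [self_mem_nhdsWithin] with t ht
        exact (Real.sqrt_pos.2 ht).ne'
    have h0 : phaseError θ ((0 : ℝ) * w) = 0 := by
      have := abs_phaseError_le hθ ((0 : ℝ) * w)
      simpa using this
    have h2 := (hd.comp hs).pow 2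
    rw [neg_sq] at h2
    refine h2.congr' ?_
    filter_upwards [self_mem_nhdsWithin] with t ht
    have ht0 : 0 < t := ht
    rw [Function.comp_apply, slope_def_field, h0, sub_zero, sub_zero, div_pow, Real.sq_sqrt ht0.le]

theorem measurable_noisyPhaseError (θ : ℝ) : Measurable (noisyPhaseError θ) := by
  have := isProbabilityMeasure_complexGaussian one_pos
  have h : StronglyMeasurable fun p : ℝ × ℂ => phaseError θ (Real.sqrt p.1 * p.2) ^ 2 := by
    refine Measurable.stronglyMeasurable (((measurable_phaseError θ).comp ?_).pow_const 2)
    fun_prop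
  exact h.integral_prod_right'.measurable

/-! ### Conditional error given the amplitudes -/

theorem isProbabilityMeasure_readingLaw {η nB : ℝ} (hη : η ∈ Set.Ioo (0 : ℝ) 1) (hnB : 0 < nB)
    (θ : ℝ) {n : ℕ} (α : Fin n → ℂ) : IsProbabilityMeasure (readingLaw η nB θ α) := by
  have h1η : 0 < 1 - η := by linarith [hη.2]
  have := isProbabilityMeasure_complexGaussian (by positivity : 0 < 1 + nB * (1 - η))
  have hp : ∀ i, IsProbabilityMeasure
      (heterodyneLaw (sensorOutput η nB θ (coherentState (α i)))) := fun i => by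
    rw [heterodyneLaw_sensorOutput hη hnB]
    exact Measure.isProbabilityMeasure_map (by fun_prop)
  rw [readingLaw]
  infer_instance

theorem integral_arctanEstimator {η nB : ℝ} (hη : η ∈ Set.Ioo (0 : ℝ) 1) (hnB : 0 < nB)
    (θ : ℝ) {n : ℕ} (α : Fin n → ℂ) :
    ∫ x, (θ - arctanEstimator α x) ^ 2 ∂(readingLaw η nB θ α) =
      if ∑ i, ‖α i‖ ^ 2 = 0 then θ ^ 2 else
        noisyPhaseError θ ((1 + nB * (1 - η)) / (η * ∑ i, ‖α i‖ ^ 2)) := by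
  have h1η : 0 < 1 - η := by linarith [hη.2]
  have := isProbabilityMeasure_readingLaw hη hnB θ α
  split_ifs with hA
  · have h0 : ∀ i, α i = 0 := fun i => by
      rw [Finset.sum_eq_zero_iff_of_nonneg fun i _ => by positivity] at hA
      simpa using hA i (Finset.mem_univ i)
    simp [arctanEstimator, h0]
  · have hm : Measurable fun x : Fin n → ℂ => ∑ i, conj (α i) * x i :=
      Finset.measurable_sum _ fun i _ => (measurable_pi_apply i).const_mul _
    have hf : Measurable fun S : ℂ => (θ - Real.arctan (S.im / S.re)) ^ 2 :=
      (measurable_const.sub (Real.measurable_arctan.comp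
        (Complex.measurable_im.div Complex.measurable_re))).pow_const 2
    have e : ∀ x, (θ - arctanEstimator α x) ^ 2 =
        (fun S : ℂ => (θ - Real.arctan (S.im / S.re)) ^ 2) (∑ i, conj (α i) * x i) := fun x => by
      simp only [arctanEstimator, Complex.im_sum, Complex.re_sum]
    simp only [e]
    rw [← integral_map hm.aemeasurable hf.aestronglyMeasurable, readingLaw_map_sum hη hnB,
      integral_map (by fun_prop) hf.aestronglyMeasurable, noisyPhaseError]
    have hApos : 0 < ∑ i, ‖α i‖ ^ 2 :=
      lt_of_le_of_ne (Finset.sum_nonneg fun i _ => by positivity) (Ne.symm hA)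
    set A := ∑ i, ‖α i‖ ^ 2
    congr 1
    ext w
    rw [phaseError]
    set V := 1 + nB * (1 - η)
    have hV : 0 < V := by positivity
    have hη0 := hη.1
    have hr := Real.sqrt_pos.2 hη0
    have hsq : Real.sqrt (V * A) = Real.sqrt η * A * Real.sqrt (V / (η * A)) := by
      rw [Real.sqrt_eq_iff_mul_self_eq (by positivity) (by positivity), eq_comm]
      have h1 := Real.mul_self_sqrt (by positivity : 0 ≤ V / (η * A))
      have h2 := Real.mul_self_sqrt hη0.le
      calc _ = (Real.sqrt η * Real.sqrt η) * A ^ 2 *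
            (Real.sqrt (V / (η * A)) * Real.sqrt (V / (η * A))) := by ring
        _ = _ := by rw [h1, h2]; field_simp
    -- The positive real factor `√η A` cancels in the ratio under the arctangent, leaving
    -- `phaseError`.
    have hS : Complex.exp (Complex.I * θ) * (Real.sqrt η * (A : ℝ)) +
        Complex.exp (Complex.I * θ) * Real.sqrt (V * A) * w = ((Real.sqrt η * A : ℝ) : ℂ) *
          (Complex.exp (Complex.I * θ) * (1 + Real.sqrt (V / (η * A)) * w)) := by
      rw [hsq]
      push_cast
      ring
    rw [hS, Complex.re_ofReal_mul, Complex.im_ofReal_mul, mul_div_mul_left _ _ (by positivity)]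

/-! ### Asymptotics of the mean squared error -/

/-- If `X n` concentrates at `1` with variance at most `1 / n`, and `φ n` is a bounded function that
equals `g (κ / (√n X n))` where `X n > 0`, and `g t ∼ L t` as `t → 0`, then
`√n ∫ φ n → κ L`. -/
theorem tendsto_sqrt_mul_integral {Ω : ℕ → Type*} [∀ n, MeasurableSpace (Ω n)]
    {μ : ∀ n, Measure (Ω n)} {X φ : ∀ n, Ω n → ℝ} {g : ℝ → ℝ} {κ L M : ℝ} (hκ : 0 < κ) (hL : 0 < L)
    (hM : 0 ≤ M) (hμ : ∀ n, 1 ≤ n → IsProbabilityMeasure (μ n))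
    (hX : ∀ n, 1 ≤ n → Integrable (fun ω => (X n ω - 1) ^ 2) (μ n))
    (hvar : ∀ n, 1 ≤ n → ∫ ω, (X n ω - 1) ^ 2 ∂(μ n) ≤ 1 / (n : ℝ))
    (hφm : ∀ n, 1 ≤ n → AEStronglyMeasurable (φ n) (μ n))
    (hφ0 : ∀ n ω, 0 ≤ φ n ω) (hφM : ∀ n ω, φ n ω ≤ M)
    (hφ : ∀ n ω, 0 < X n ω → φ n ω = g (κ / (Real.sqrt n * X n ω)))
    (hg : Tendsto (fun t => g t / t) (nhdsWithin 0 (Set.Ioi 0)) (nhds L)) :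
    Tendsto (fun n : ℕ => Real.sqrt n * ∫ ω, φ n ω ∂(μ n)) atTop (nhds (κ * L)) := by
  rw [Metric.tendsto_atTop']
  intro e he
  -- `r` is both the tolerance for `g t / t` and the width of the window for `X`; `r ≤ 1/2` keeps `X
  -- ≥ 1/2` in the window.
  obtain ⟨r, hr0, hr1, hre⟩ : ∃ r : ℝ, 0 < r ∧ r ≤ 1 / 2 ∧ κ * (2 * r * (1 + L)) ≤ e / 2 := by
    refine ⟨min (1 / 2) (e / (4 * κ * (1 + L))), by positivity, min_le_left _ _, ?_⟩
    have := min_le_right (1 / 2 : ℝ) (e / (4 * κ * (1 + L)))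
    rw [le_div_iff₀ (by positivity)] at this
    linarith
  rw [Metric.tendsto_nhdsWithin_nhds] at hg
  obtain ⟨d, hd0, hd⟩ := hg r hr0
  have hsqrt : Tendsto (fun n : ℕ => Real.sqrt n) atTop atTop :=
    Real.tendsto_sqrt_atTop.comp tendsto_natCast_atTop_atTop
  have hsmall : Tendsto (fun n : ℕ => 2 * κ / Real.sqrt n) atTop (nhds 0) :=
    hsqrt.const_div_atTop _
  have hrest : Tendsto (fun n : ℕ => M / r ^ 2 / Real.sqrt n + κ * L / r ^ 2 / n) atTop
      (nhds (0 + 0)) :=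
    (hsqrt.const_div_atTop _).add (tendsto_natCast_atTop_atTop.const_div_atTop _)
  rw [add_zero] at hrest
  have hev := ((hsmall.eventually (gt_mem_nhds hd0)).and
    (hrest.eventually (gt_mem_nhds (half_pos he)))).and (eventually_ge_atTop 1)
  obtain ⟨n₀, hn₀⟩ := eventually_atTop.1 hev
  refine ⟨n₀, fun n hn => ?_⟩
  obtain ⟨⟨h1, h2⟩, hn1⟩ := hn₀ n hn.le
  have := hμ n hn1
  have hn0 : (0 : ℝ) < n := by exact_mod_cast hn1
  have hs0 : 0 < Real.sqrt n := Real.sqrt_pos.2 hn0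
  have hφi : Integrable (φ n) (μ n) := Integrable.of_bound (C := M) (hφm n hn1)
    (ae_of_all _ fun ω => by rw [Real.norm_of_nonneg (hφ0 n ω)]; exact hφM n ω)
  -- Within the window the error is linear in `r`. Outside it, the crude bound is multiplied by `(X
  -- - 1)² / r² ≥ 1` as in Chebyshev's inequality, so that integration brings in the variance `1 /
  -- n`, which beats `√n M`.
  have hpt : ∀ ω, |Real.sqrt n * φ n ω - κ * L| ≤
      κ * (2 * r * (1 + L)) + (Real.sqrt n * M + κ * L) / r ^ 2 * (X n ω - 1) ^ 2 := by
    intro ω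
    by_cases hω : |X n ω - 1| ≤ r
    · have hX1 : 1 / 2 ≤ X n ω := by linarith [(abs_le.1 hω).1]
      have hX0 : 0 < X n ω := by linarith
      set t := κ / (Real.sqrt n * X n ω) with ht
      have ht0 : 0 < t := by positivity
      have htd : t < d := by
        refine lt_of_le_of_lt ?_ h1
        rw [ht, div_le_div_iff₀ (by positivity) hs0]
        nlinarith [mul_pos hκ hs0]
      have hgt := hd (show t ∈ Set.Ioi (0 : ℝ) from ht0)
        (by rw [Real.dist_eq, sub_zero, abs_of_pos ht0]; exact htd)
      rw [Real.dist_eq] at hgt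
      have hval : Real.sqrt n * φ n ω - κ * L =
          κ * ((g t / t - L) / X n ω + L * ((1 - X n ω) / X n ω)) := by
        rw [hφ n ω hX0, ← ht]
        have : g t = g t / t * t := by field_simp
        rw [this]
        generalize g t / t = q
        rw [ht]
        field_simp
        ring
      have hinv : 1 / X n ω ≤ 2 := by rw [div_le_iff₀ hX0]; linarith
      have b1 : |(g t / t - L) / X n ω| ≤ r * 2 := by
        rw [abs_div, abs_of_pos hX0, div_eq_mul_one_div]
        exact mul_le_mul hgt.le hinv (by positivity) hr0.le
      have b2 : |L * ((1 - X n ω) / X n ω)| ≤ L * (r * 2) := by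
        rw [abs_mul, abs_of_pos hL, abs_div, abs_of_pos hX0, div_eq_mul_one_div, abs_sub_comm]
        exact mul_le_mul_of_nonneg_left (mul_le_mul hω hinv (by positivity) hr0.le) hL.le
      have b3 : 0 ≤ (Real.sqrt n * M + κ * L) / r ^ 2 * (X n ω - 1) ^ 2 := by positivity
      rw [hval, abs_mul, abs_of_pos hκ]
      have b4 := (abs_add_le ((g t / t - L) / X n ω) (L * ((1 - X n ω) / X n ω))).trans
        (add_le_add b1 b2)
      have b5 := mul_le_mul_of_nonneg_left b4 hκ.le
      linarith
    · push Not at hω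
      have b1 : |Real.sqrt n * φ n ω - κ * L| ≤ Real.sqrt n * M + κ * L := by
        have c1 := mul_le_mul_of_nonneg_left (hφM n ω) hs0.le
        have c2 := mul_nonneg hs0.le (hφ0 n ω)
        have c3 := mul_pos hκ hL
        rw [abs_le]
        constructor <;> linarith
      have b2 : 1 ≤ (X n ω - 1) ^ 2 / r ^ 2 := by
        rw [le_div_iff₀ (by positivity), one_mul, ← sq_abs (X n ω - 1)]
        exact pow_le_pow_left₀ hr0.le hω.le 2
      have b3 : 0 ≤ Real.sqrt n * M + κ * L := by positivity
      have b4 : 0 ≤ κ * (2 * r * (1 + L)) := by positivity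
      have b5 := mul_le_mul_of_nonneg_left b2 b3
      rw [mul_one] at b5
      calc _ ≤ _ := b1
        _ ≤ _ := b5
        _ = (Real.sqrt n * M + κ * L) / r ^ 2 * (X n ω - 1) ^ 2 := by ring
        _ ≤ _ := by linarith
  have hint : Real.sqrt n * ∫ ω, φ n ω ∂(μ n) - κ * L =
      ∫ ω, (Real.sqrt n * φ n ω - κ * L) ∂(μ n) := by
    rw [integral_sub (hφi.const_mul _) (integrable_const _), integral_const_mul]
    simp
  rw [Real.dist_eq, hint]
  calc _ ≤ ∫ ω, |Real.sqrt n * φ n ω - κ * L| ∂(μ n) := abs_integral_le_integral_abs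
    _ ≤ ∫ ω, (κ * (2 * r * (1 + L)) + (Real.sqrt n * M + κ * L) / r ^ 2 * (X n ω - 1) ^ 2) ∂(μ n) :=
        integral_mono ((hφi.const_mul _).sub (integrable_const _)).abs
          ((integrable_const _).add ((hX n hn1).const_mul _)) hpt
    _ = κ * (2 * r * (1 + L)) +
          (Real.sqrt n * M + κ * L) / r ^ 2 * ∫ ω, (X n ω - 1) ^ 2 ∂(μ n) := by
        rw [integral_add (integrable_const _) ((hX n hn1).const_mul _), integral_const,
          integral_const_mul]
        simp
    _ ≤ κ * (2 * r * (1 + L)) + (Real.sqrt n * M + κ * L) / r ^ 2 * (1 / n) := by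
        have : 0 ≤ (Real.sqrt n * M + κ * L) / r ^ 2 := by positivity
        gcongr
        exact hvar n hn1
    _ = κ * (2 * r * (1 + L)) + (M / r ^ 2 / Real.sqrt n + κ * L / r ^ 2 / n) := by
        have : Real.sqrt n / n = 1 / Real.sqrt n := Real.sqrt_div_self'
        rw [show (Real.sqrt n * M + κ * L) / r ^ 2 * (1 / n) =
          M / r ^ 2 * (Real.sqrt n / n) + κ * L / r ^ 2 / n by ring, this]
        ring
    _ < e := by linarith

/-- The variable `‖α i‖²` has mean `N` and variance `N²`, so the relative variance of the sum is `1
/ n` whatever `N` is. This matters because the covert photon number tends to `0` as `n` grows. -/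
theorem integral_probe_energy_sub_sq {N : ℝ} (hN : 0 < N) {n : ℕ} (hn : 1 ≤ n) :
    Integrable (fun α : Fin n → ℂ => ((∑ i, ‖α i‖ ^ 2) / (n * N) - 1) ^ 2) (probeLaw n N) ∧
      ∫ α, ((∑ i, ‖α i‖ ^ 2) / (n * N) - 1) ^ 2 ∂(probeLaw n N) = 1 / (n : ℝ) := by
  have := isProbabilityMeasure_complexGaussian hN
  have hn0 : (0 : ℝ) < n := by exact_mod_cast hn
  have hprob : IsProbabilityMeasure (probeLaw n N) := by unfold probeLaw; infer_instance
  have h2 := integral_norm_pow_complexGaussian hN 1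
  have h4 := integral_norm_pow_complexGaussian hN 2
  have i4 := integrable_norm_pow_complexGaussian hN 2
  simp only [mul_one, Nat.factorial_one, Nat.cast_one, pow_one, one_mul] at h2
  have hL2 : MemLp (fun z : ℂ => ‖z‖ ^ 2) 2 (complexGaussian N) := by
    rw [memLp_two_iff_integrable_sq (by fun_prop)]
    refine i4.congr (ae_of_all _ fun z => ?_)
    simp only
    rw [← pow_mul]
  have hvar1 : ProbabilityTheory.variance (fun z : ℂ => ‖z‖ ^ 2) (complexGaussian N) = N ^ 2 := by
    rw [ProbabilityTheory.variance_eq_sub hL2, h2]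
    have : ∫ z, ((fun z : ℂ => ‖z‖ ^ 2) ^ 2) z ∂(complexGaussian N) = 2 * N ^ 2 := by
      have e : (((2 : ℕ).factorial : ℕ) : ℝ) = 2 := by norm_num [Nat.factorial]
      rw [← e, ← h4]
      congr 1
      ext z
      rw [Pi.pow_apply, ← pow_mul]
    rw [this]
    ring
  have hvar := ProbabilityTheory.variance_sum_pi (ι := Fin n) (μ := fun _ => complexGaussian N)
    (X := fun _ z => ‖z‖ ^ 2) (fun _ => hL2)
  simp only [hvar1, Finset.sum_const, Finset.card_univ, Fintype.card_fin, nsmul_eq_mul] at hvar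
  have hmem : ∀ i, MemLp (fun α : Fin n → ℂ => ‖α i‖ ^ 2) 2 (probeLaw n N) := fun i =>
    hL2.comp_measurePreserving (measurePreserving_eval (fun _ : Fin n => complexGaussian N) i)
  have hmean : ∫ α, (∑ i, fun α : Fin n → ℂ => ‖α i‖ ^ 2) α ∂(probeLaw n N) = n * N := by
    simp only [Finset.sum_apply]
    rw [integral_finsetSum _ fun i _ => (hmem i).integrable (by norm_num)]
    have : ∀ i : Fin n, ∫ α, ‖α i‖ ^ 2 ∂(probeLaw n N) = N := fun i => by
      rw [probeLaw, integral_comp_eval (μ := fun _ : Fin n => complexGaussian N)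
        (f := fun z => ‖z‖ ^ 2) (by fun_prop), h2]
    simp [this]
  have hsum : MemLp (∑ i, fun α : Fin n → ℂ => ‖α i‖ ^ 2) 2 (probeLaw n N) :=
    memLp_finsetSum' _ fun i _ => hmem i
  have hform : (fun α : Fin n → ℂ => ((∑ i, ‖α i‖ ^ 2) / (n * N) - 1) ^ 2) = fun α =>
      ((∑ i, fun α : Fin n → ℂ => ‖α i‖ ^ 2) α - n * N) ^ 2 / (n * N) ^ 2 := by
    ext α
    rw [Finset.sum_apply]
    field_simp
  rw [hform]
  refine ⟨((hsum.sub (memLp_const _)).integrable_sq).div_const _, ?_⟩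
  rw [integral_div]
  rw [← probeLaw, ProbabilityTheory.variance_eq_integral hsum.aemeasurable, hmean] at hvar
  rw [hvar]
  field_simp

theorem tendsto_sqrt_mul_meanSquaredError {η nB ε θ : ℝ} (hη : η ∈ Set.Ioo (0 : ℝ) 1)
    (hnB : 0 < nB) (hε : 0 < ε) (hθ : θ ∈ Set.Ioo (-(Real.pi / 2)) (Real.pi / 2)) :
    Tendsto (fun n : ℕ => Real.sqrt n *
      meanSquaredError η nB (covertPhotonNumber η nB ε n) θ n) atTop (nhds (cHet η nB / ε)) := by
  have h1η : 0 < 1 - η := by linarith [hη.2]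
  have hη0 := hη.1
  have hV : 0 < 1 + nB * (1 - η) := by positivity
  have hR : 0 < Real.sqrt (η * nB * (1 + η * nB)) := Real.sqrt_pos.2 (by positivity)
  have hnS : ∀ n : ℕ, 1 ≤ n → 0 < covertPhotonNumber η nB ε n := fun n hn => by
    have : (0 : ℝ) < n := by exact_mod_cast hn
    have := Real.sqrt_pos.2 this
    unfold covertPhotonNumber
    positivity
  have hc : 0 < cHet η nB := by unfold cHet; positivity
  -- Since `n nS = √n · 4ε √(η nB (1 + η nB)) / (1 - η)`, the noise-to-signal ratio is `κ / (√n X)`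
  -- with `κ = 2 cHet / ε`; the slope `L = 1 / 2` then gives the limit `cHet / ε`.
  have key := tendsto_sqrt_mul_integral (Ω := fun n => Fin n → ℂ)
    (μ := fun n => probeLaw n (covertPhotonNumber η nB ε n))
    (X := fun n α => (∑ i, ‖α i‖ ^ 2) / (n * covertPhotonNumber η nB ε n))
    (φ := fun n α => ∫ x, (θ - arctanEstimator α x) ^ 2 ∂(readingLaw η nB θ α))
    (g := noisyPhaseError θ) (κ := 2 * (cHet η nB / ε)) (L := 1 / 2) (M := Real.pi ^ 2)
    (by positivity) (by norm_num) (by positivity) ?_ (fun n hn =>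
      (integral_probe_energy_sub_sq (hnS n hn) hn).1) (fun n hn =>
      (integral_probe_energy_sub_sq (hnS n hn) hn).2.le) ?_ ?_ ?_ ?_
    (tendsto_noisyPhaseError_div hθ)
  · rw [show 2 * (cHet η nB / ε) * (1 / 2) = cHet η nB / ε by ring] at key
    exact key
  · intro n hn
    have := isProbabilityMeasure_complexGaussian (hnS n hn)
    unfold probeLaw
    infer_instance
  · intro n _
    simp only [integral_arctanEstimator hη hnB]
    refine Measurable.aestronglyMeasurable ?_
    have hA : Measurable fun α : Fin n → ℂ => ∑ i, ‖α i‖ ^ 2 := by fun_prop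
    refine Measurable.ite (measurableSet_eq_fun hA measurable_const) measurable_const ?_
    exact (measurable_noisyPhaseError θ).comp (measurable_const.div (hA.const_mul η))
  · intro n α
    exact integral_nonneg fun x => sq_nonneg _
  · intro n α
    have := isProbabilityMeasure_readingLaw hη hnB θ α
    calc _ ≤ ∫ _, Real.pi ^ 2 ∂(readingLaw η nB θ α) := by
          refine integral_mono_of_nonneg (ae_of_all _ fun x => sq_nonneg _) (integrable_const _)
            (ae_of_all _ fun x => ?_)
          simp only
          rw [← sq_abs]
          exact pow_le_pow_left₀ (abs_nonneg _) (abs_sub_arctan_le hθ _) 2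
      _ = Real.pi ^ 2 := by simp
  · intro n α hX
    -- For `n = 0` the normalized energy is `0 / 0 = 0`, which `hX` excludes.
    have hn : 1 ≤ n := by
      rcases Nat.eq_zero_or_pos n with rfl | h
      · simp at hX
      · exact h
    have hn0 : (0 : ℝ) < n := by exact_mod_cast hn
    have hnS' := hnS n hn
    have hA : ∑ i, ‖α i‖ ^ 2 ≠ 0 := fun h => by rw [h, zero_div] at hX; exact hX.false
    rw [integral_arctanEstimator hη hnB, if_neg hA]
    congr 1
    have hs := Real.sqrt_pos.2 hn0
    have hss := Real.mul_self_sqrt hn0.le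
    have e : (n : ℝ) * covertPhotonNumber η nB ε n =
        Real.sqrt n * (4 * ε * Real.sqrt (η * nB * (1 + η * nB)) / (1 - η)) := by
      rw [covertPhotonNumber]
      nth_rewrite 1 [← hss]
      field_simp
    rw [e, cHet]
    field_simp
    ring

end CovertSensing

theorem theorem2 (η nB ε : ℝ) (hη : η ∈ Set.Ioo (0 : ℝ) 1) (hnB : 0 < nB) (hε : 0 < ε) :
    (∀ n : ℕ, 1 ≤ n →
      ∀ E : CovertSensing.FockSpace n →L[ℂ] CovertSensing.FockSpace n, 0 ≤ E → E ≤ 1 →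
        1 / 2 - ε ≤
          CovertSensing.detectionError η nB (CovertSensing.covertPhotonNumber η nB ε n) E) ∧
    ∀ θ ∈ Set.Ioo (-(Real.pi / 2)) (Real.pi / 2),
      ((fun n : ℕ => CovertSensing.meanSquaredError η nB
          (CovertSensing.covertPhotonNumber η nB ε n) θ n)
        =O[atTop] fun n : ℕ => 1 / Real.sqrt n) ∧
      ((fun n : ℕ => CovertSensing.meanSquaredError η nB
          (CovertSensing.covertPhotonNumber η nB ε n) θ n)
        ~[atTop] fun n : ℕ => CovertSensing.cHet η nB / (ε * Real.sqrt n)) := by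
  refine ⟨fun n hn E hE hE1 => CovertSensing.detectionError_ge hη hnB hε hn hE hE1, fun θ hθ => ?_⟩
  have hc : 0 < CovertSensing.cHet η nB := by
    have h1η : 0 < 1 - η := by linarith [hη.2]
    have hη0 := hη.1
    have hR : 0 < Real.sqrt (η * nB * (1 + η * nB)) := Real.sqrt_pos.2 (by positivity)
    unfold CovertSensing.cHet
    positivity
  have hequiv : (fun n : ℕ => CovertSensing.meanSquaredError η nB
      (CovertSensing.covertPhotonNumber η nB ε n) θ n)
        ~[atTop] fun n : ℕ => CovertSensing.cHet η nB / (ε * Real.sqrt n) := by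
    rw [isEquivalent_iff_tendsto_one]
    · have h := (CovertSensing.tendsto_sqrt_mul_meanSquaredError hη hnB hε hθ).div_const
        (CovertSensing.cHet η nB / ε)
      rw [div_self (by positivity)] at h
      refine h.congr fun n => ?_
      rw [Pi.div_apply]
      field_simp
    · filter_upwards [eventually_ge_atTop 1] with n hn
      have hn0 : (0 : ℝ) < n := by exact_mod_cast hn
      have := Real.sqrt_pos.2 hn0
      positivity
  refine ⟨hequiv.isBigO.trans ?_, hequiv⟩
  have e : (fun n : ℕ => CovertSensing.cHet η nB / (ε * Real.sqrt n)) =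
      fun n : ℕ => CovertSensing.cHet η nB / ε * (1 / Real.sqrt n) := by
    ext n
    field_simp
  rw [e]
  exact (isBigO_refl _ _).const_mul_left _
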